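/- A directed graph $E=(E^0,E^1,r,s)$ consists of arbitrary sets $E^0\neq\emptyset$ (vertices) and $E^1$ (edges) with source and range maps $s,r:E^1\to E^0$. For vertices $u,v$ write $u\geq v$ if there is a path (possibly of length $0$) from $u$ to $v$. A cycle based at a vertex $v$ is a path $e_1\cdots e_n$ of length $n\geq 1$ from $v$ to $v$ with $s(e_i)\neq s(e_j)$ for all $i\neq j$; an exit for it is an edge $f$ such that, for some $i$, $s(f)=s(e_i)$ and $f\neq e_i$. For a field $K$, the Leavitt path algebra $L_K(E)$ is the associative (not necessarily unital) $K$-algebra generated by $\{v\mid v\in E^0\}\cup\{e,e^*\mid e\in E^1\}$ subject to the relations (V) $vw=\delta_{v,w}v$ for $v,w\in E^0$; (E1) $s(e)e=e\,r(e)=e$ for $e\in E^1$; (E2) $r(e)e^*=e^*s(e)=e^*$ for $e\in E^1$; (CK1) $e^*e'=\delta_{e,e'}r(e)$ for $e,e'\in E^1$; (CK2) $v=\sum_{s(e)=v}ee^*$ for every $v\in E^0$ with $1\leq|s^{-1}(v)|<\infty$. A (not necessarily unital) ring $R$ is left primitive if it has a faithful simple left module, where a left module $M$ is simple if $RM\neq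 0$ and its only submodules are $0$ and $M$; it is right primitive if the opposite ring of $R$ is left primitive. **Theorem.** Let $E$ be an arbitrary directed graph with $E^0\neq\emptyset$ and $K$ any field. Then the following three conditions together are necessary and sufficient for $L_K(E)$ to be left primitive, and likewise for $L_K(E)$ to be right primitive: (i) (Condition (MT3)) for every pair of vertices $v,w$ there is a vertex $u$ with $v\geq u$ and $w\geq u$; (ii) (Condition (L)) every cycle in $E$ has an exit; (iii) ($E^0$ has the Countable Separation Property) there is an at most countable set $C\subseteq E^0$ such that for every $w\in E^0$ there is $v\in C$ with $w\geq v$. -/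

import Mathlib

universe k u w x

/-- A directed graph `(E⁰, E¹, r, s)`: arbitrary sets of vertices and of edges, with a source map
and a range map.  Loops and parallel edges are allowed. -/
structure DirGraph where
  /-- the set of vertices -/
  Vertex : Type u
  /-- the set of edges -/
  Edge : Type w
  /-- the source of an edge -/
  s : Edge → Vertex
  /-- the range of an edge -/
  r : Edge → Vertex

namespace DirGraph

/-- `E.IsPath u p v`: the list of edges `p = e₁ ⋯ eₙ` is a path in `E` with source `u` and range
`v`.  The empty list is the path of length `0` at `u`. -/
def IsPath (E : DirGraph.{u, w}) : E.Vertex → List E.Edge → E.Vertex → Prop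
  | u, [], v => u = v
  | u, e :: p, v => E.s e = u ∧ E.IsPath (E.r e) p v

/-- `u ≥ v`: there is a path (possibly of length `0`) with source `u` and range `v`. -/
def Reaches (E : DirGraph.{u, w}) (u v : E.Vertex) : Prop :=
  ∃ p : List E.Edge, E.IsPath u p v

/-- A cycle based at `v`: a path of positive length from `v` to `v` whose edges have pairwise
distinct sources. -/
def IsCycle (E : DirGraph.{u, w}) (v : E.Vertex) (c : List E.Edge) : Prop :=
  c ≠ [] ∧ E.IsPath v c v ∧ (c.map E.s).Nodup

/-- The edge `f` is an exit for the path `p = e₁ ⋯ eₙ`: for some `i`, `s f = s eᵢ` and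
`f ≠ eᵢ`. -/
def IsExit (E : DirGraph.{u, w}) (f : E.Edge) (p : List E.Edge) : Prop :=
  ∃ e ∈ p, E.s f = E.s e ∧ f ≠ e

/-- Condition (MT3): any two vertices have a common descendant. -/
def ConditionMT3 (E : DirGraph.{u, w}) : Prop :=
  ∀ v v' : E.Vertex, ∃ x : E.Vertex, E.Reaches v x ∧ E.Reaches v' x

/-- Condition (L): every cycle has an exit. -/
def ConditionL (E : DirGraph.{u, w}) : Prop :=
  ∀ (v : E.Vertex) (c : List E.Edge), E.IsCycle v c → ∃ f : E.Edge, E.IsExit f c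

/-- The Countable Separation Property of a set `S` of vertices: there is an at most countable set
`C` of vertices such that every element of `S` reaches some element of `C`. -/
def HasCSP (E : DirGraph.{u, w}) (S : Set E.Vertex) : Prop :=
  ∃ C : Set E.Vertex, C.Countable ∧ ∀ x ∈ S, ∃ v ∈ C, E.Reaches x v

end DirGraph

/-- The generators `v`, `e`, `e*` of the Leavitt path algebra of `E`. -/
inductive LeavittGen (E : DirGraph.{u, w}) : Type (max u w)
  | vertex : E.Vertex → LeavittGen E
  | edge : E.Edge → LeavittGen E
  | ghost : E.Edge → LeavittGen E

/-- The free associative (not necessarily unital) `K`-algebra on the generators of the Leavitt path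
algebra: the semigroup algebra of the free semigroup. -/
abbrev FreeLeavitt (K : Type k) [Field K] (E : DirGraph.{u, w}) : Type (max k u w) :=
  MonoidAlgebra K (FreeSemigroup (LeavittGen E))

namespace FreeLeavitt

/-- A generator, as an element of the free algebra. -/
noncomputable def gen (K : Type k) [Field K] {E : DirGraph.{u, w}} (x : LeavittGen E) :
    FreeLeavitt K E :=
  MonoidAlgebra.ofMagma K (FreeSemigroup (LeavittGen E)) (FreeSemigroup.of x)

end FreeLeavitt

open FreeLeavitt LeavittGen in
/-- The defining relations (V), (E1), (E2), (CK1), (CK2) of the Leavitt path algebra. -/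
inductive LeavittRel (K : Type k) [Field K] (E : DirGraph.{u, w}) :
    FreeLeavitt K E → FreeLeavitt K E → Prop
  | vertex_mul_self (v : E.Vertex) :
      LeavittRel K E (gen K (vertex v) * gen K (vertex v)) (gen K (vertex v))
  | vertex_mul_of_ne (v v' : E.Vertex) (h : v ≠ v') :
      LeavittRel K E (gen K (vertex v) * gen K (vertex v')) 0
  | source_mul_edge (e : E.Edge) :
      LeavittRel K E (gen K (vertex (E.s e)) * gen K (edge e)) (gen K (edge e))
  | edge_mul_range (e : E.Edge) :
      LeavittRel K E (gen K (edge e) * gen K (vertex (E.r e))) (gen K (edge e))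
  | range_mul_ghost (e : E.Edge) :
      LeavittRel K E (gen K (vertex (E.r e)) * gen K (ghost e)) (gen K (ghost e))
  | ghost_mul_source (e : E.Edge) :
      LeavittRel K E (gen K (ghost e) * gen K (vertex (E.s e))) (gen K (ghost e))
  | ghost_mul_edge_self (e : E.Edge) :
      LeavittRel K E (gen K (ghost e) * gen K (edge e)) (gen K (vertex (E.r e)))
  | ghost_mul_edge_of_ne (e e' : E.Edge) (h : e ≠ e') :
      LeavittRel K E (gen K (ghost e) * gen K (edge e')) 0
  | vertex_eq_sum (v : E.Vertex) (hne : {e : E.Edge | E.s e = v}.Nonempty)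
      (hfin : {e : E.Edge | E.s e = v}.Finite) :
      LeavittRel K E (gen K (vertex v)) (∑ e ∈ hfin.toFinset, gen K (edge e) * gen K (ghost e))

/-- The `K`-algebra congruence generated by the defining relations.  The free algebra has no unit,
so closure under scalars is ensured by imposing all scalar multiples of the relations. -/
noncomputable def leavittCon (K : Type k) [Field K] (E : DirGraph.{u, w}) :
    RingCon (FreeLeavitt K E) :=
  ringConGen fun x y =>
    ∃ (c : K) (a b : FreeLeavitt K E), LeavittRel K E a b ∧ x = c • a ∧ y = c • b

theorem leavittCon_smul (K : Type k) [Field K] (E : DirGraph.{u, w}) (c : K)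
    {x y : FreeLeavitt K E} (h : leavittCon K E x y) : leavittCon K E (c • x) (c • y) := by
  have h' : RingConGen.Rel (fun x y => ∃ (c : K) (a b : FreeLeavitt K E),
      LeavittRel K E a b ∧ x = c • a ∧ y = c • b) x y := h
  clear h
  induction h' with
  | of x y hxy =>
    obtain ⟨d, a, b, hab, rfl, rfl⟩ := hxy
    exact RingConGen.Rel.of _ _ ⟨c * d, a, b, hab, smul_smul _ _ _, smul_smul _ _ _⟩
  | refl x => exact (leavittCon K E).refl _
  | symm _ ih => exact (leavittCon K E).symm ih
  | trans _ _ ih₁ ih₂ => exact (leavittCon K E).trans ih₁ ih₂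
  | add _ _ ih₁ ih₂ =>
    rw [smul_add, smul_add]
    exact (leavittCon K E).add ih₁ ih₂
  | mul _ h₂ ih₁ _ =>
    rw [← smul_mul_assoc, ← smul_mul_assoc]
    exact (leavittCon K E).mul ih₁ h₂

/-- The Leavitt path algebra `L_K(E)`: the associative `K`-algebra generated by the symbols `v`,
`e`, `e*` subject to the relations (V), (E1), (E2), (CK1), (CK2).  It need not have a unit. -/
def LeavittPathAlgebra (K : Type k) [Field K] (E : DirGraph.{u, w}) :
    Type (max k u w) :=
  (leavittCon K E).Quotient

namespace LeavittPathAlgebra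

noncomputable instance instNonUnitalRing (K : Type k) [Field K] (E : DirGraph.{u, w}) :
    NonUnitalRing (LeavittPathAlgebra K E) :=
  inferInstanceAs (NonUnitalRing (leavittCon K E).Quotient)

/-- The quotient map from the free algebra. -/
noncomputable def mk (K : Type k) [Field K] (E : DirGraph.{u, w}) :
    FreeLeavitt K E →ₙ+* LeavittPathAlgebra K E where
  toFun x := ((x : (leavittCon K E).Quotient) : LeavittPathAlgebra K E)
  map_mul' _ _ := rfl
  map_zero' := rfl
  map_add' _ _ := rfl

theorem mk_surjective (K : Type k) [Field K] (E : DirGraph.{u, w}) :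
    Function.Surjective (mk K E) :=
  Quotient.mk_surjective

noncomputable instance instSMul (K : Type k) [Field K] (E : DirGraph.{u, w}) :
    SMul K (LeavittPathAlgebra K E) where
  smul c := Quotient.map (fun x => c • x) fun _ _ h => leavittCon_smul K E c h

theorem smul_mk (K : Type k) [Field K] (E : DirGraph.{u, w}) (c : K)
    (x : FreeLeavitt K E) : c • mk K E x = mk K E (c • x) :=
  rfl

noncomputable instance instModule (K : Type k) [Field K] (E : DirGraph.{u, w}) :
    Module K (LeavittPathAlgebra K E) :=
  Function.Surjective.module K (mk K E : FreeLeavitt K E →+ LeavittPathAlgebra K E)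
    (mk_surjective K E) fun c x => (smul_mk K E c x).symm

instance instIsScalarTower (K : Type k) [Field K] (E : DirGraph.{u, w}) :
    IsScalarTower K (LeavittPathAlgebra K E) (LeavittPathAlgebra K E) where
  smul_assoc c x y := by
    obtain ⟨x, rfl⟩ := mk_surjective K E x
    obtain ⟨y, rfl⟩ := mk_surjective K E y
    simp only [smul_eq_mul, smul_mk, ← map_mul, smul_mul_assoc]

instance instSMulCommClass (K : Type k) [Field K] (E : DirGraph.{u, w}) :
    SMulCommClass K (LeavittPathAlgebra K E) (LeavittPathAlgebra K E) where
  smul_comm c x y := by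
    obtain ⟨x, rfl⟩ := mk_surjective K E x
    obtain ⟨y, rfl⟩ := mk_surjective K E y
    simp only [smul_eq_mul, smul_mk, ← map_mul, mul_smul_comm]

end LeavittPathAlgebra

/-- A (not necessarily unital) ring `R` is left primitive if it has a simple faithful left module.
A left `R`-module is an abelian group `M` with a ring homomorphism `ρ` from `R` to the
endomorphisms of `M`; it is simple if `RM ≠ 0` and its only submodules are `0` and `M`; it is
faithful if only `0` annihilates it.  A simple module is a quotient of the left module `R`, so it
may be taken in the universe of `R`. -/
def IsLeftPrimitive (R : Type x) [NonUnitalRing R] : Prop :=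
  ∃ (M : Type x) (_ : AddCommGroup M) (ρ : R →ₙ+* AddMonoid.End M),
    (∃ (a : R) (m : M), ρ a m ≠ 0) ∧
    (∀ N : AddSubgroup M, (∀ (a : R), ∀ m ∈ N, ρ a m ∈ N) → N = ⊥ ∨ N = ⊤) ∧
    (∀ a : R, (∀ m : M, ρ a m = 0) → a = 0)

/-- A ring is right primitive if its opposite ring is left primitive. -/
def IsRightPrimitive (R : Type x) [NonUnitalRing R] : Prop :=
  IsLeftPrimitive Rᵐᵒᵖ

/-! Exchanging `e` and `e*` identifies the algebra `L` with its opposite, so only left primitivity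
needs work. `L` is spanned by the monomials `p q*`, and two tools carry the rest. The first is a
representation on functions (`exists_shift_representation`) in which an unbranched path acts as a
shift; the same construction shows that vertices are nonzero. The second is Cuntz–Krieger uniqueness
(`injective_of_conditionL`): under (L), a ring homomorphism that kills no vertex is injective.

Sufficiency: (MT3) and countable separation give paths `p₀, p₁, …` from one vertex `v`, each a
prefix of the next, such that every vertex reaches the range of some `pₙ`. The elements `a` with `a
pₙ = 0` for some `n` form a left ideal modulo which `v` is a right identity. A maximal left ideal
`P` above it omits `v`, and `L/P` is simple. Since `pₙ pₙ* ≡ v` modulo `P`, no vertex annihilates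
`L/P`, and uniqueness makes it faithful.

Necessity: let `M` be a faithful simple module. If `v` and `w` have no common descendant, then `v L
w = 0`, although `w M ≠ 0` generates `M`; so `v` kills `M`, which is absurd. If a cycle `c` at `v`
has no exit, the corner `v L v` is commutative, and simplicity makes the nonzero element `v - c`
invertible in it; but in the shift representation every function in the image of `v - c` vanishes at
the points over `v` fixed by the shift. For countable separation, fix `m = v m ≠ 0` and consider the
tree of paths `q` from `v` with `q* m ≠ 0`. Either some node branches infinitely, and then every
vertex reaches its range, or the tree is countable and the ranges of its paths separate. -/

namespace LeavittPathAlgebra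

/-! ### Universal property and involution -/

/-- The image of a generator in the Leavitt path algebra. -/
noncomputable def gen (K : Type k) [Field K] {E : DirGraph.{u, w}} (g : LeavittGen E) :
    LeavittPathAlgebra K E :=
  mk K E (FreeLeavitt.gen K g)

/-- The idempotent of a vertex. -/
noncomputable abbrev vtx (K : Type k) [Field K] {E : DirGraph.{u, w}} (v : E.Vertex) :
    LeavittPathAlgebra K E :=
  gen K (.vertex v)

/-- The element of an edge. -/
noncomputable abbrev edg (K : Type k) [Field K] {E : DirGraph.{u, w}} (e : E.Edge) :
    LeavittPathAlgebra K E :=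
  gen K (.edge e)

/-- The element of a ghost edge. -/
noncomputable abbrev gho (K : Type k) [Field K] {E : DirGraph.{u, w}} (e : E.Edge) :
    LeavittPathAlgebra K E :=
  gen K (.ghost e)

/-- A family of elements of a ring indexed by the generators and satisfying the relations
(V), (E1), (E2), (CK1), (CK2). -/
structure IsLeavittFamily {E : DirGraph.{u, w}} {A : Type x} [NonUnitalRing A]
    (f : LeavittGen E → A) : Prop where
  vertex_mul_self (v : E.Vertex) : f (.vertex v) * f (.vertex v) = f (.vertex v)
  vertex_mul_of_ne (v v' : E.Vertex) (h : v ≠ v') : f (.vertex v) * f (.vertex v') = 0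
  source_mul_edge (e : E.Edge) : f (.vertex (E.s e)) * f (.edge e) = f (.edge e)
  edge_mul_range (e : E.Edge) : f (.edge e) * f (.vertex (E.r e)) = f (.edge e)
  range_mul_ghost (e : E.Edge) : f (.vertex (E.r e)) * f (.ghost e) = f (.ghost e)
  ghost_mul_source (e : E.Edge) : f (.ghost e) * f (.vertex (E.s e)) = f (.ghost e)
  ghost_mul_edge_self (e : E.Edge) : f (.ghost e) * f (.edge e) = f (.vertex (E.r e))
  ghost_mul_edge_of_ne (e e' : E.Edge) (h : e ≠ e') : f (.ghost e) * f (.edge e') = 0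
  vertex_eq_sum (v : E.Vertex) (hne : {e : E.Edge | E.s e = v}.Nonempty)
    (hfin : {e : E.Edge | E.s e = v}.Finite) :
    f (.vertex v) = ∑ e ∈ hfin.toFinset, f (.edge e) * f (.ghost e)

section

variable {K : Type k} [Field K] {E : DirGraph.{u, w}}

theorem mk_eq_mk_of_rel {a b : FreeLeavitt K E} (h : LeavittRel K E a b) :
    mk K E a = mk K E b :=
  Quotient.sound (RingConGen.Rel.of _ _ ⟨1, a, b, h, (one_smul _ _).symm, (one_smul _ _).symm⟩)

variable (K E) in
theorem isLeavittFamily_gen : IsLeavittFamily (gen K : LeavittGen E → _) where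
  vertex_mul_self v := (map_mul (mk K E) _ _).symm.trans (mk_eq_mk_of_rel (.vertex_mul_self v))
  vertex_mul_of_ne v v' h :=
    (map_mul (mk K E) _ _).symm.trans (mk_eq_mk_of_rel (.vertex_mul_of_ne v v' h))
  source_mul_edge e := (map_mul (mk K E) _ _).symm.trans (mk_eq_mk_of_rel (.source_mul_edge e))
  edge_mul_range e := (map_mul (mk K E) _ _).symm.trans (mk_eq_mk_of_rel (.edge_mul_range e))
  range_mul_ghost e := (map_mul (mk K E) _ _).symm.trans (mk_eq_mk_of_rel (.range_mul_ghost e))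
  ghost_mul_source e := (map_mul (mk K E) _ _).symm.trans (mk_eq_mk_of_rel (.ghost_mul_source e))
  ghost_mul_edge_self e :=
    (map_mul (mk K E) _ _).symm.trans (mk_eq_mk_of_rel (.ghost_mul_edge_self e))
  ghost_mul_edge_of_ne e e' h :=
    (map_mul (mk K E) _ _).symm.trans (mk_eq_mk_of_rel (.ghost_mul_edge_of_ne e e' h))
  vertex_eq_sum v hne hfin := by
    refine (mk_eq_mk_of_rel (.vertex_eq_sum v hne hfin)).trans ?_
    rw [map_sum]
    exact Finset.sum_congr rfl fun e _ => map_mul _ _ _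

/-- Words are built by prepending letters, so closure under left multiplication by generators
suffices. -/
theorem induction_on {p : LeavittPathAlgebra K E → Prop} (a : LeavittPathAlgebra K E)
    (gen : ∀ g, p (gen K g)) (gen_mul : ∀ g a, p a → p (LeavittPathAlgebra.gen K g * a))
    (zero : p 0) (add : ∀ a b, p a → p b → p (a + b)) (smul : ∀ (c : K) a, p a → p (c • a)) :
    p a := by
  obtain ⟨a, rfl⟩ := mk_surjective K E a
  have key : ∀ y : FreeSemigroup (LeavittGen E),
      p (mk K E (MonoidAlgebra.ofMagma K (FreeSemigroup (LeavittGen E)) y)) := by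
    intro y
    refine FreeSemigroup.recOnMul y gen fun g y _ ih => ?_
    rw [map_mul, map_mul]
    exact gen_mul g _ ih
  induction a using MonoidAlgebra.induction_linear with
  | zero => rw [map_zero]; exact zero
  | add a b ha hb => rw [map_add]; exact add _ _ ha hb
  | single m c =>
    have : MonoidAlgebra.single m c =
        c • MonoidAlgebra.ofMagma K (FreeSemigroup (LeavittGen E)) m := by
      simp
    rw [this, ← smul_mk]
    exact smul _ _ (key m)

section Lift

variable {A : Type x} [NonUnitalRing A] [Module K A] [IsScalarTower K A A] [SMulCommClass K A A]

/-- The homomorphism of the free algebra with given values on the generators. -/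
noncomputable def freeLift (f : LeavittGen E → A) : FreeLeavitt K E →ₙₐ[K] A :=
  MonoidAlgebra.liftMagma K (FreeSemigroup.lift f)

theorem freeLift_gen (f : LeavittGen E → A) (g : LeavittGen E) :
    freeLift (K := K) f (FreeLeavitt.gen K g) = f g := by
  simp [freeLift, FreeLeavitt.gen]

theorem freeLift_eq_of_rel {f : LeavittGen E → A} (hf : IsLeavittFamily f) {a b : FreeLeavitt K E}
    (h : LeavittRel K E a b) : freeLift (K := K) f a = freeLift f b := by
  cases h with
  | vertex_mul_self v => simp only [map_mul, freeLift_gen, hf.vertex_mul_self]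
  | vertex_mul_of_ne v v' h =>
    simp only [map_mul, freeLift_gen, hf.vertex_mul_of_ne v v' h, map_zero]
  | source_mul_edge e => simp only [map_mul, freeLift_gen, hf.source_mul_edge]
  | edge_mul_range e => simp only [map_mul, freeLift_gen, hf.edge_mul_range]
  | range_mul_ghost e => simp only [map_mul, freeLift_gen, hf.range_mul_ghost]
  | ghost_mul_source e => simp only [map_mul, freeLift_gen, hf.ghost_mul_source]
  | ghost_mul_edge_self e => simp only [map_mul, freeLift_gen, hf.ghost_mul_edge_self]
  | ghost_mul_edge_of_ne e e' h =>
    simp only [map_mul, freeLift_gen, hf.ghost_mul_edge_of_ne e e' h, map_zero]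
  | vertex_eq_sum v hne hfin =>
    simp only [map_sum, map_mul, freeLift_gen]
    exact hf.vertex_eq_sum v hne hfin

theorem freeLift_eq_of_leavittCon {f : LeavittGen E → A} (hf : IsLeavittFamily f)
    {a b : FreeLeavitt K E} (h : leavittCon K E a b) : freeLift (K := K) f a = freeLift f b := by
  have h' : RingConGen.Rel (fun x y => ∃ (c : K) (a b : FreeLeavitt K E),
      LeavittRel K E a b ∧ x = c • a ∧ y = c • b) a b := h
  clear h
  induction h' with
  | of x y hxy =>
    obtain ⟨c, a, b, hab, rfl, rfl⟩ := hxy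
    rw [map_smul, map_smul, freeLift_eq_of_rel hf hab]
  | refl x => rfl
  | symm _ ih => exact ih.symm
  | trans _ _ ih₁ ih₂ => exact ih₁.trans ih₂
  | add _ _ ih₁ ih₂ => rw [map_add, map_add, ih₁, ih₂]
  | mul _ _ ih₁ ih₂ => rw [map_mul, map_mul, ih₁, ih₂]

/-- The universal property of the Leavitt path algebra. -/
noncomputable def lift (f : LeavittGen E → A) (hf : IsLeavittFamily f) :
    LeavittPathAlgebra K E →ₙₐ[K] A where
  toFun := Quotient.lift (freeLift (K := K) f) fun _ _ h => freeLift_eq_of_leavittCon hf h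
  map_zero' := map_zero (freeLift (K := K) f)
  map_add' a b := by
    obtain ⟨a, rfl⟩ := mk_surjective K E a
    obtain ⟨b, rfl⟩ := mk_surjective K E b
    exact map_add (freeLift (K := K) f) a b
  map_mul' a b := by
    obtain ⟨a, rfl⟩ := mk_surjective K E a
    obtain ⟨b, rfl⟩ := mk_surjective K E b
    exact map_mul (freeLift (K := K) f) a b
  map_smul' c a := by
    obtain ⟨a, rfl⟩ := mk_surjective K E a
    exact map_smul (freeLift (K := K) f) c a

theorem lift_gen (f : LeavittGen E → A) (hf : IsLeavittFamily f) (g : LeavittGen E) :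
    lift f hf (gen K g) = f g :=
  freeLift_gen f g

end Lift

/-- The involution on generators. -/
def starGen : LeavittGen E → LeavittGen E
  | .vertex v => .vertex v
  | .edge e => .ghost e
  | .ghost e => .edge e

open MulOpposite in
variable (K E) in
theorem isLeavittFamily_op_starGen :
    IsLeavittFamily fun g : LeavittGen E => op (gen K (starGen g)) where
  vertex_mul_self v := congrArg op ((isLeavittFamily_gen K E).vertex_mul_self v)
  vertex_mul_of_ne v v' h := congrArg op ((isLeavittFamily_gen K E).vertex_mul_of_ne v' v h.symm)
  source_mul_edge e := congrArg op ((isLeavittFamily_gen K E).ghost_mul_source e)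
  edge_mul_range e := congrArg op ((isLeavittFamily_gen K E).range_mul_ghost e)
  range_mul_ghost e := congrArg op ((isLeavittFamily_gen K E).edge_mul_range e)
  ghost_mul_source e := congrArg op ((isLeavittFamily_gen K E).source_mul_edge e)
  ghost_mul_edge_self e := congrArg op ((isLeavittFamily_gen K E).ghost_mul_edge_self e)
  ghost_mul_edge_of_ne e e' h :=
    congrArg op ((isLeavittFamily_gen K E).ghost_mul_edge_of_ne e' e h.symm)
  vertex_eq_sum v hne hfin := by
    refine (congrArg op ((isLeavittFamily_gen K E).vertex_eq_sum v hne hfin)).trans ?_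
    exact map_sum (opAddEquiv (α := LeavittPathAlgebra K E)) _ _

variable (K E) in
/-- The involution of the Leavitt path algebra, as a homomorphism to the opposite ring. -/
noncomputable def starHom : LeavittPathAlgebra K E →ₙₐ[K] (LeavittPathAlgebra K E)ᵐᵒᵖ :=
  lift _ (isLeavittFamily_op_starGen K E)

theorem starHom_gen (g : LeavittGen E) :
    starHom K E (gen K g) = MulOpposite.op (gen K (starGen g)) :=
  lift_gen _ _ g

theorem unop_starHom_unop_starHom (a : LeavittPathAlgebra K E) :
    (starHom K E (starHom K E a).unop).unop = a := by
  induction a using induction_on with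
  | gen g => cases g <;> simp [starHom_gen, starGen]
  | gen_mul g a ih =>
    rw [map_mul, MulOpposite.unop_mul, map_mul, MulOpposite.unop_mul, ih]
    cases g <;> simp [starHom_gen, starGen]
  | zero => simp
  | add a b ha hb => simp [ha, hb]
  | smul c a ih => simp [ih]

variable (K E) in
/-- The Leavitt path algebra is isomorphic to its opposite. -/
noncomputable def opEquiv : LeavittPathAlgebra K E ≃+* (LeavittPathAlgebra K E)ᵐᵒᵖ where
  toFun := starHom K E
  invFun a := (starHom K E a.unop).unop
  left_inv := unop_starHom_unop_starHom
  right_inv a := MulOpposite.unop_injective (unop_starHom_unop_starHom a.unop)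
  map_mul' := map_mul _
  map_add' := map_add _

end

end LeavittPathAlgebra

theorem IsLeftPrimitive.of_ringEquiv {R S : Type x} [NonUnitalRing R] [NonUnitalRing S]
    (h : IsLeftPrimitive R) (f : R ≃+* S) : IsLeftPrimitive S := by
  obtain ⟨M, _, ρ, ⟨a, m, ham⟩, hs, hf⟩ := h
  refine ⟨M, inferInstance, ρ.comp (f.symm : S →ₙ+* R), ⟨f a, m, by simpa using ham⟩, ?_, ?_⟩
  · refine fun N hN => hs N fun a m hm => ?_
    simpa using hN (f a) m hm
  · intro a ha
    exact f.symm.map_eq_zero_iff.mp (hf _ ha)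

theorem isRightPrimitive_leavittPathAlgebra_iff (K : Type k) [Field K] (E : DirGraph.{u, w}) :
    IsRightPrimitive (LeavittPathAlgebra K E) ↔ IsLeftPrimitive (LeavittPathAlgebra K E) :=
  ⟨fun h => IsLeftPrimitive.of_ringEquiv h (LeavittPathAlgebra.opEquiv K E).symm,
    fun h => h.of_ringEquiv (LeavittPathAlgebra.opEquiv K E)⟩

/-! ### Paths and the spanning monomials `p q*` -/

namespace DirGraph

variable {E : DirGraph.{u, w}}

theorem isPath_append {u v : E.Vertex} {p q : List E.Edge} :
    E.IsPath u (p ++ q) v ↔ ∃ x, E.IsPath u p x ∧ E.IsPath x q v := by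
  induction p generalizing u with
  | nil => simp [IsPath]
  | cons e p ih => simp [IsPath, ih, and_assoc]

theorem IsPath.append {u v x : E.Vertex} {p q : List E.Edge} (hp : E.IsPath u p v)
    (hq : E.IsPath v q x) : E.IsPath u (p ++ q) x :=
  isPath_append.2 ⟨v, hp, hq⟩

theorem IsPath.range_unique {u v v' : E.Vertex} {p : List E.Edge} (h : E.IsPath u p v)
    (h' : E.IsPath u p v') : v = v' := by
  induction p generalizing u with
  | nil => exact Eq.trans (Eq.symm h) h'
  | cons e p ih => exact ih h.2 h'.2

theorem IsPath.of_append {u v x : E.Vertex} {p q : List E.Edge} (hp : E.IsPath u p v)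
    (h : E.IsPath u (p ++ q) x) : E.IsPath v q x := by
  obtain ⟨y, hy, hq⟩ := isPath_append.1 h
  rwa [hp.range_unique hy]

theorem isPath_singleton {e : E.Edge} : E.IsPath (E.s e) [e] (E.r e) := ⟨rfl, rfl⟩

theorem Reaches.refl (v : E.Vertex) : E.Reaches v v := ⟨[], rfl⟩

theorem Reaches.trans {u v x : E.Vertex} (h : E.Reaches u v) (h' : E.Reaches v x) :
    E.Reaches u x := by
  obtain ⟨p, hp⟩ := h
  obtain ⟨q, hq⟩ := h'
  exact ⟨p ++ q, hp.append hq⟩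

end DirGraph

namespace LeavittPathAlgebra

open DirGraph

section

variable (K : Type k) [Field K] {E : DirGraph.{u, w}}

/-- The element of the Leavitt path algebra given by a path with source `u`. -/
noncomputable def pth (u : E.Vertex) : List E.Edge → LeavittPathAlgebra K E
  | [] => vtx K u
  | e :: p => edg K e * pth (E.r e) p

/-- The element of the Leavitt path algebra given by the ghost of a path with source `u`. -/
noncomputable def gpth (u : E.Vertex) : List E.Edge → LeavittPathAlgebra K E
  | [] => vtx K u
  | e :: p => gpth (E.r e) p * gho K e

variable {K}

theorem vtx_mul_self (v : E.Vertex) : vtx K v * vtx K v = vtx K v :=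
  (isLeavittFamily_gen K E).vertex_mul_self v

theorem vtx_mul_of_ne {v v' : E.Vertex} (h : v ≠ v') : vtx K v * vtx K v' = 0 :=
  (isLeavittFamily_gen K E).vertex_mul_of_ne v v' h

theorem vtx_mul_edg (e : E.Edge) : vtx K (E.s e) * edg K e = edg K e :=
  (isLeavittFamily_gen K E).source_mul_edge e

theorem edg_mul_vtx (e : E.Edge) : edg K e * vtx K (E.r e) = edg K e :=
  (isLeavittFamily_gen K E).edge_mul_range e

theorem vtx_mul_gho (e : E.Edge) : vtx K (E.r e) * gho K e = gho K e :=
  (isLeavittFamily_gen K E).range_mul_ghost e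

theorem gho_mul_vtx (e : E.Edge) : gho K e * vtx K (E.s e) = gho K e :=
  (isLeavittFamily_gen K E).ghost_mul_source e

theorem gho_mul_edg (e : E.Edge) : gho K e * edg K e = vtx K (E.r e) :=
  (isLeavittFamily_gen K E).ghost_mul_edge_self e

theorem gho_mul_edg_of_ne {e e' : E.Edge} (h : e ≠ e') : gho K e * edg K e' = 0 :=
  (isLeavittFamily_gen K E).ghost_mul_edge_of_ne e e' h

theorem vtx_mul_pth {u v : E.Vertex} {p : List E.Edge} (h : E.IsPath u p v) :
    vtx K u * pth K u p = pth K u p := by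
  cases p with
  | nil => exact vtx_mul_self u
  | cons e p =>
    obtain ⟨rfl, -⟩ := h
    rw [pth, ← mul_assoc, vtx_mul_edg]

theorem pth_mul_vtx {u v : E.Vertex} {p : List E.Edge} (h : E.IsPath u p v) :
    pth K u p * vtx K v = pth K u p := by
  induction p generalizing u with
  | nil =>
    obtain rfl : u = v := h
    exact vtx_mul_self u
  | cons e p ih => rw [pth, mul_assoc, ih h.2]

theorem gpth_mul_vtx {u v : E.Vertex} {p : List E.Edge} (h : E.IsPath u p v) :
    gpth K u p * vtx K u = gpth K u p := by
  cases p with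
  | nil => exact vtx_mul_self u
  | cons e p =>
    obtain ⟨rfl, -⟩ := h
    rw [gpth, mul_assoc, gho_mul_vtx]

theorem vtx_mul_gpth {u v : E.Vertex} {p : List E.Edge} (h : E.IsPath u p v) :
    vtx K v * gpth K u p = gpth K u p := by
  induction p generalizing u with
  | nil =>
    obtain rfl : u = v := h
    exact vtx_mul_self u
  | cons e p ih => rw [gpth, ← mul_assoc, ih h.2]

theorem pth_append {u v x : E.Vertex} {p q : List E.Edge} (hp : E.IsPath u p v)
    (hq : E.IsPath v q x) : pth K u (p ++ q) = pth K u p * pth K v q := by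
  induction p generalizing u with
  | nil =>
    obtain rfl : u = v := hp
    exact (vtx_mul_pth hq).symm
  | cons e p ih => rw [List.cons_append, pth, ih hp.2, pth, mul_assoc]

theorem gpth_append {u v x : E.Vertex} {p q : List E.Edge} (hp : E.IsPath u p v)
    (hq : E.IsPath v q x) : gpth K u (p ++ q) = gpth K v q * gpth K u p := by
  induction p generalizing u with
  | nil =>
    obtain rfl : u = v := hp
    exact (gpth_mul_vtx hq).symm
  | cons e p ih => rw [List.cons_append, gpth, ih hp.2, gpth, mul_assoc]

theorem gpth_mul_pth_self {u v : E.Vertex} {p : List E.Edge} (hp : E.IsPath u p v) :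
    gpth K u p * pth K u p = vtx K v := by
  induction p generalizing u with
  | nil =>
    obtain rfl : u = v := hp
    exact vtx_mul_self u
  | cons e p ih =>
    obtain ⟨rfl, hp⟩ := hp
    rw [gpth, pth, mul_assoc, ← mul_assoc (gho K e), gho_mul_edg, vtx_mul_pth hp, ih hp]

theorem gpth_mul_pth_append {u v x : E.Vertex} {p q : List E.Edge} (hp : E.IsPath u p v)
    (hq : E.IsPath v q x) : gpth K u p * pth K u (p ++ q) = pth K v q := by
  rw [pth_append hp hq, ← mul_assoc, gpth_mul_pth_self hp, vtx_mul_pth hq]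

theorem gpth_append_mul_pth {u v x : E.Vertex} {p q : List E.Edge} (hp : E.IsPath u p v)
    (hq : E.IsPath v q x) : gpth K u (p ++ q) * pth K u p = gpth K v q := by
  rw [gpth_append hp hq, mul_assoc, gpth_mul_pth_self hp, gpth_mul_vtx hq]

/-- Incomparable paths first disagree at two distinct edges, and there (CK1) gives zero. -/
theorem gpth_mul_pth_eq_zero {u v x : E.Vertex} {p q : List E.Edge} (hp : E.IsPath u p v)
    (hq : E.IsPath u q x) (hpq : ¬ p <+: q) (hqp : ¬ q <+: p) :
    gpth K u p * pth K u q = 0 := by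
  induction p generalizing u q with
  | nil => simp at hpq
  | cons e p ih =>
    cases q with
    | nil => simp at hqp
    | cons f q =>
      rw [gpth, pth, mul_assoc, ← mul_assoc (gho K e)]
      by_cases hef : e = f
      · subst hef
        rw [gho_mul_edg, vtx_mul_pth hq.2]
        exact ih hp.2 hq.2 (by simpa using hpq) (by simpa using hqp)
      · rw [gho_mul_edg_of_ne hef, zero_mul, mul_zero]

theorem pth_singleton (e : E.Edge) : pth K (E.s e) [e] = edg K e := edg_mul_vtx e

theorem gpth_singleton (e : E.Edge) : gpth K (E.s e) [e] = gho K e := vtx_mul_gho e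

variable (K) in
/-- The monomials `p q*`. -/
def monomials (E : DirGraph.{u, w}) : Set (LeavittPathAlgebra K E) :=
  {a | ∃ u v x p q, E.IsPath u p x ∧ E.IsPath v q x ∧ a = pth K u p * gpth K v q}

/-- The product is a monomial or zero: a ghost edge either meets the first edge of `p` or, when `p`
is trivial, is absorbed into `q*`. -/
theorem gen_mul_monomial (g : LeavittGen E) {a : LeavittPathAlgebra K E}
    (ha : a ∈ monomials K E) : gen K g * a ∈ Submodule.span K (monomials K E) := by
  obtain ⟨u, v, x, p, q, hp, hq, rfl⟩ := ha
  rw [← mul_assoc]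
  cases g with
  | vertex y =>
    by_cases hy : y = u
    · subst hy
      rw [vtx_mul_pth hp]
      exact Submodule.subset_span ⟨_, _, _, _, _, hp, hq, rfl⟩
    · rw [← vtx_mul_pth hp, ← mul_assoc, vtx_mul_of_ne hy, zero_mul, zero_mul]
      exact zero_mem _
  | edge e =>
    by_cases hy : E.r e = u
    · subst hy
      exact Submodule.subset_span ⟨E.s e, v, x, e :: p, q, ⟨rfl, hp⟩, hq, rfl⟩
    · change edg K e * pth K u p * gpth K v q ∈ _
      rw [← vtx_mul_pth hp, ← edg_mul_vtx e, ← mul_assoc, mul_assoc (edg K e), vtx_mul_of_ne hy,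
        mul_zero, zero_mul, zero_mul]
      exact zero_mem _
  | ghost e =>
    cases p with
    | nil =>
      obtain rfl : u = x := hp
      rw [pth]
      by_cases hy : E.s e = u
      · subst hy
        refine Submodule.subset_span
          ⟨E.r e, v, E.r e, [], q ++ [e], rfl, hq.append isPath_singleton, ?_⟩
        rw [gho_mul_vtx, gpth_append hq isPath_singleton, gpth_singleton, pth, ← mul_assoc,
          vtx_mul_gho]
      · change gho K e * vtx K u * gpth K v q ∈ _
        rw [← gho_mul_vtx e, mul_assoc, mul_assoc, ← mul_assoc (vtx K (E.s e)), vtx_mul_of_ne hy,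
          zero_mul, mul_zero]
        exact zero_mem _
    | cons f p =>
      obtain ⟨rfl, hp⟩ := hp
      rw [pth, ← mul_assoc]
      by_cases hef : e = f
      · subst hef
        rw [gho_mul_edg, vtx_mul_pth hp]
        exact Submodule.subset_span ⟨_, _, _, _, _, hp, hq, rfl⟩
      · rw [gho_mul_edg_of_ne hef, zero_mul, zero_mul]
        exact zero_mem _

theorem gen_mem_span_monomials (g : LeavittGen E) :
    gen K g ∈ Submodule.span K (monomials K E) := by
  refine Submodule.subset_span ?_
  cases g with
  | vertex v => exact ⟨v, v, v, [], [], rfl, rfl, (vtx_mul_self v).symm⟩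
  | edge e =>
    refine ⟨E.s e, E.r e, E.r e, [e], [], isPath_singleton, rfl, ?_⟩
    rw [pth_singleton]
    exact (edg_mul_vtx e).symm
  | ghost e =>
    refine ⟨E.r e, E.s e, E.r e, [], [e], rfl, isPath_singleton, ?_⟩
    rw [gpth_singleton]
    exact (vtx_mul_gho e).symm

variable (K E) in
theorem span_monomials : Submodule.span K (monomials K E) = ⊤ := by
  refine eq_top_iff.2 fun a _ => ?_
  induction a using induction_on with
  | gen g => exact gen_mem_span_monomials g
  | gen_mul g a ih =>
    specialize ih trivial
    clear * - ih
    induction ih using Submodule.span_induction with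
    | mem a ha => exact gen_mul_monomial g ha
    | zero => rw [mul_zero]; exact zero_mem _
    | add a b _ _ ha hb => rw [mul_add]; exact add_mem ha hb
    | smul c a _ ha => rw [mul_smul_comm]; exact Submodule.smul_mem _ _ ha
  | zero => exact zero_mem _
  | add a b ha hb => exact add_mem (ha trivial) (hb trivial)
  | smul c a ha => exact Submodule.smul_mem _ _ (ha trivial)

theorem monomial_induction {P : LeavittPathAlgebra K E → Prop} (a : LeavittPathAlgebra K E)
    (monomial : ∀ u v x p q, E.IsPath u p x → E.IsPath v q x → P (pth K u p * gpth K v q))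
    (zero : P 0) (add : ∀ a b, P a → P b → P (a + b)) (smul : ∀ (c : K) a, P a → P (c • a)) :
    P a := by
  have ha : a ∈ Submodule.span K (monomials K E) := by rw [span_monomials]; trivial
  induction ha using Submodule.span_induction with
  | mem a ha =>
    obtain ⟨u, v, x, p, q, hp, hq, rfl⟩ := ha
    exact monomial u v x p q hp hq
  | zero => exact zero
  | add a b _ _ ha hb => exact add a b ha hb
  | smul c a _ ha => exact smul c a ha

end

end LeavittPathAlgebra

/-! ### A representation by shifts -/

namespace DirGraph

open Cardinal in
/-- There are injections `φ e` of a set into itself, one for each edge, such that the ranges for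
the edges with a given source partition the set, and `φ e` is the shift when `e` is the only edge
with its source. -/
theorem exists_edge_injections (E : DirGraph.{u, w}) :
    ∃ φ : E.Edge → (E.Edge ⊕ ℤ) → (E.Edge ⊕ ℤ),
      (∀ e, Function.Injective (φ e)) ∧
      (∀ e f y z, E.s e = E.s f → φ e y = φ f z → e = f) ∧
      (∀ e y, ∃ f z, E.s f = E.s e ∧ φ f z = y) ∧
      (∀ e, (∀ f, E.s f = E.s e → f = e) → ∀ y, φ e y = Sum.map id (· + 1) y) := by
  have key : ∀ v : E.Vertex, ∃ φ : {e // E.s e = v} → (E.Edge ⊕ ℤ) → (E.Edge ⊕ ℤ),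
      (∀ e, Function.Injective (φ e)) ∧
      (∀ e f y z, φ e y = φ f z → e = f) ∧
      (∀ (_ : {e // E.s e = v}) y, ∃ f z, φ f z = y) ∧
      (∀ e, (∀ f, f = e) → ∀ y, φ e y = Sum.map id (· + 1) y) := by
    intro v
    by_cases hsub : ∃ e : {e // E.s e = v}, ∀ f, f = e
    · obtain ⟨e, he⟩ := hsub
      refine ⟨fun _ => Sum.map id (· + 1), fun _ => ?_, fun f g _ _ _ => (he f).trans (he g).symm,
        fun _ y => ⟨e, Sum.map id (· - 1) y, ?_⟩, fun _ _ _ => rfl⟩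
      · exact Function.Injective.sumMap Function.injective_id (add_left_injective 1)
      · cases y <;> simp
    · by_cases hne : Nonempty {e // E.s e = v}
      -- The summand `ℤ` makes the set infinite and the summand `E.Edge` makes it at least as large
      -- as the set of edges out of `v`, so it splits into that many copies of itself.
      · have h1 : #{e // E.s e = v} * #(E.Edge ⊕ ℤ) = #(E.Edge ⊕ ℤ) := by
          refine Cardinal.mul_eq_right (Cardinal.aleph0_le_mk _) ?_ ?_
          · exact Cardinal.mk_le_of_injective (f := fun e => Sum.inl e.1)
              fun e f h => Subtype.ext (Sum.inl_injective h)
          · exact Cardinal.mk_ne_zero_iff.2 hne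
        rw [Cardinal.mul_def] at h1
        obtain ⟨ψ⟩ := Cardinal.eq.1 h1
        refine ⟨fun e y => ψ (e, y), fun e y z h => ?_, fun e f y z h => ?_, fun _ y => ?_,
          fun e he => absurd ⟨e, he⟩ hsub⟩
        · exact (Prod.ext_iff.1 (ψ.injective h)).2
        · exact (Prod.ext_iff.1 (ψ.injective h)).1
        · exact ⟨(ψ.symm y).1, (ψ.symm y).2, by simp⟩
      · exact ⟨fun _ => id, fun e => absurd ⟨e⟩ hne, fun e => absurd ⟨e⟩ hne,
          fun e => absurd ⟨e⟩ hne, fun e => absurd ⟨e⟩ hne⟩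
  choose φ h1 h2 h3 h4 using key
  refine ⟨fun e => φ (E.s e) ⟨e, rfl⟩, fun e => h1 _ _, ?_, ?_, ?_⟩
  · intro e f y z hs h
    have aux : ∀ v (hf : E.s f = v), φ (E.s f) ⟨f, rfl⟩ z = φ v ⟨f, hf⟩ z := by
      rintro v rfl
      rfl
    have h := h.trans (aux _ hs.symm)
    simpa using h2 _ _ _ _ _ h
  · intro e y
    obtain ⟨⟨f, hf⟩, z, h⟩ := h3 (E.s e) ⟨e, rfl⟩ y
    refine ⟨f, z, hf, ?_⟩
    have aux : ∀ v (hf : E.s f = v), φ (E.s f) ⟨f, rfl⟩ z = φ v ⟨f, hf⟩ z := by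
      rintro v rfl
      rfl
    exact (aux _ hf).trans h
  · intro e he
    exact h4 _ _ fun f => Subtype.ext (he f.1 f.2)

end DirGraph

namespace LeavittPathAlgebra

open DirGraph Classical in
/-- The operators on functions on `E⁰ × Y` defined by a family of injections of `Y`. -/
noncomputable def repGen (K : Type k) [Field K] {E : DirGraph.{u, w}} {Y : Type w}
    (φ : E.Edge → Y → Y) : LeavittGen E → Module.End K (E.Vertex × Y → K)
  | .vertex v =>
    { toFun f x := if x.1 = v then f x else 0
      map_add' f g := by ext x; by_cases h : x.1 = v <;> simp [h]
      map_smul' c f := by ext x; by_cases h : x.1 = v <;> simp [h] }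
  | .edge e =>
    { toFun f x := if h : x.1 = E.s e ∧ ∃ y, φ e y = x.2 then f (E.r e, h.2.choose) else 0
      map_add' f g := by
        ext x
        by_cases h : x.1 = E.s e ∧ ∃ y, φ e y = x.2
        · simp only [dif_pos h, Pi.add_apply]
        · simp only [dif_neg h, Pi.add_apply, add_zero]
      map_smul' c f := by
        ext x
        by_cases h : x.1 = E.s e ∧ ∃ y, φ e y = x.2
        · simp only [dif_pos h, Pi.smul_apply, RingHom.id_apply]
        · simp only [dif_neg h, Pi.smul_apply, smul_zero] }
  | .ghost e =>
    { toFun f x := if x.1 = E.r e then f (E.s e, φ e x.2) else 0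
      map_add' f g := by ext x; by_cases h : x.1 = E.r e <;> simp [h]
      map_smul' c f := by ext x; by_cases h : x.1 = E.r e <;> simp [h] }

section

variable {K : Type k} [Field K] {E : DirGraph.{u, w}} {Y : Type w} {φ : E.Edge → Y → Y}

open Classical in
theorem repGen_vertex_apply (v : E.Vertex) (f : E.Vertex × Y → K) (x : E.Vertex × Y) :
    repGen K φ (.vertex v) f x = if x.1 = v then f x else 0 :=
  rfl

open Classical in
theorem repGen_ghost_apply (e : E.Edge) (f : E.Vertex × Y → K) (x : E.Vertex × Y) :
    repGen K φ (.ghost e) f x = if x.1 = E.r e then f (E.s e, φ e x.2) else 0 :=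
  rfl

open Classical in
theorem repGen_edge_apply_image {e : E.Edge} (h : Function.Injective (φ e)) (f : E.Vertex × Y → K)
    (y : Y) : repGen K φ (.edge e) f (E.s e, φ e y) = f (E.r e, y) := by
  have h' : ∃ z, φ e z = φ e y := ⟨y, rfl⟩
  change (if h : E.s e = E.s e ∧ ∃ z, φ e z = φ e y then f (E.r e, h.2.choose) else 0) = _
  rw [dif_pos ⟨rfl, h'⟩, h h'.choose_spec]

theorem repGen_edge_apply_of_ne {e : E.Edge} (f : E.Vertex × Y → K) {v : E.Vertex} {z : Y}
    (h : v = E.s e → ∀ y, φ e y ≠ z) : repGen K φ (.edge e) f (v, z) = 0 :=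
  dif_neg fun h' => h'.2.elim (h h'.1)

open Classical in
theorem repGen_edge_ext {e : E.Edge} {f g : E.Vertex × Y → K}
    (h : ∀ y, f (E.r e, y) = g (E.r e, y)) : repGen K φ (.edge e) f = repGen K φ (.edge e) g := by
  ext x
  change dite _ _ _ = dite _ _ _
  congr 1
  ext h'
  exact h _

/-- Injectivity gives `e* e = r(e)`, disjointness of the images gives `e* f = 0`, and their covering
`Y` gives (CK2). Disjointness is needed only for edges with a common source, since the vertex
coordinate separates the others. -/
theorem isLeavittFamily_repGen (h1 : ∀ e, Function.Injective (φ e))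
    (h2 : ∀ e f y z, E.s e = E.s f → φ e y = φ f z → e = f)
    (h3 : ∀ e y, ∃ f z, E.s f = E.s e ∧ φ f z = y) : IsLeavittFamily (repGen K φ) where
  vertex_mul_self v := by
    ext1 f
    ext1 x
    simp only [Module.End.mul_apply, repGen_vertex_apply]
    split_ifs <;> rfl
  vertex_mul_of_ne v v' h := by
    ext1 f
    ext1 x
    simp only [Module.End.mul_apply, repGen_vertex_apply]
    split_ifs with h1 h2
    · exact absurd (h1.symm.trans h2) h
    · rfl
    · rfl
  source_mul_edge e := by
    ext1 f
    ext1 x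
    simp only [Module.End.mul_apply, repGen_vertex_apply]
    split_ifs with h
    · rfl
    · exact (repGen_edge_apply_of_ne f fun h' => absurd h' h).symm
  edge_mul_range e := by
    ext1 f
    refine repGen_edge_ext fun y => ?_
    rw [repGen_vertex_apply, if_pos rfl]
  range_mul_ghost e := by
    ext1 f
    ext1 x
    simp only [Module.End.mul_apply, repGen_vertex_apply, repGen_ghost_apply]
    split_ifs <;> rfl
  ghost_mul_source e := by
    ext1 f
    ext1 x
    simp only [Module.End.mul_apply, repGen_vertex_apply, repGen_ghost_apply, if_true]
  ghost_mul_edge_self e := by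
    ext1 f
    ext1 ⟨v, y⟩
    simp only [Module.End.mul_apply, repGen_vertex_apply, repGen_ghost_apply]
    split_ifs with h
    · subst h
      exact repGen_edge_apply_image (h1 e) f y
    · rfl
  ghost_mul_edge_of_ne e e' hne := by
    ext1 f
    ext1 ⟨v, y⟩
    simp only [Module.End.mul_apply, repGen_ghost_apply]
    split_ifs with h
    · exact repGen_edge_apply_of_ne f fun hs z hz => hne (h2 _ _ _ _ hs hz.symm)
    · rfl
  vertex_eq_sum v hne hfin := by
    ext1 f
    ext1 ⟨v', y⟩
    simp only [LinearMap.sum_apply, Finset.sum_apply, Module.End.mul_apply, repGen_vertex_apply]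
    obtain ⟨e₀, rfl⟩ := hne
    split_ifs with h
    · subst h
      obtain ⟨e, z, hs, rfl⟩ := h3 e₀ y
      rw [Finset.sum_eq_single e]
      · simp only [← hs]
        rw [repGen_edge_apply_image (h1 e), repGen_ghost_apply, if_pos rfl]
      · intro e' _ hne
        refine repGen_edge_apply_of_ne _ fun hs' z' hz' => hne ?_
        exact h2 _ _ _ _ (hs'.symm.trans hs.symm) hz'
      · intro h
        exact absurd (by simpa using hs) h
    · refine (Finset.sum_eq_zero fun e he => ?_).symm
      refine repGen_edge_apply_of_ne _ fun hs => absurd (hs.trans ?_) h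
      simpa using he

end

section

variable (K : Type k) [Field K] {E : DirGraph.{u, w}}

theorem vtx_ne_zero (v : E.Vertex) : vtx K v ≠ 0 := by
  obtain ⟨φ, h1, h2, h3, -⟩ := E.exists_edge_injections
  intro h
  have h' := congrArg (lift _ (isLeavittFamily_repGen (K := K) h1 h2 h3)) h
  rw [lift_gen, map_zero] at h'
  have := congrFun (congrArg (fun T => T fun _ => 1) h') (v, Sum.inr 0)
  simp [repGen_vertex_apply] at this

/-- There is a representation in which the paths from which no path branches off act as powers of
the shift. -/
theorem exists_shift_representation (E : DirGraph.{u, w}) :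
    ∃ ρ : LeavittPathAlgebra K E →ₙₐ[K] Module.End K (E.Vertex × (E.Edge ⊕ ℤ) → K),
      ∀ (u v : E.Vertex) (p : List E.Edge), E.IsPath u p v →
        (∀ e ∈ p, ∀ f, E.s f = E.s e → f = e) → ∀ f y,
        ρ (pth K u p) f (u, Sum.map id (· + (p.length : ℤ)) y) = f (v, y) := by
  obtain ⟨φ, h1, h2, h3, h4⟩ := E.exists_edge_injections
  refine ⟨lift _ (isLeavittFamily_repGen (K := K) h1 h2 h3), ?_⟩
  intro u v p hp hb f y
  change lift _ (isLeavittFamily_repGen (K := K) h1 h2 h3) (pth K u p) f _ = _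
  induction p generalizing u with
  | nil =>
    obtain rfl : u = v := hp
    have : Sum.map id (· + (([] : List E.Edge).length : ℤ)) y = y := by cases y <;> simp
    rw [this, pth, lift_gen, repGen_vertex_apply, if_pos rfl]
  | cons e p ih =>
    obtain ⟨rfl, hp⟩ := hp
    have : Sum.map id (· + ((e :: p).length : ℤ)) y =
        φ e (Sum.map id (· + (p.length : ℤ)) y) := by
      rw [h4 e (hb e (by simp))]
      cases y <;> simp [add_assoc]
    rw [this, pth, map_mul, lift_gen, Module.End.mul_apply, repGen_edge_apply_image (h1 e)]
    exact ih _ hp fun e he => hb e (by simp [he])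

end

end LeavittPathAlgebra

/-! ### Cuntz–Krieger uniqueness -/

theorem List.exists_of_not_nodup_map {α β : Type*} (g : α → β) :
    ∀ l : List α, ¬ (l.map g).Nodup →
      ∃ a x b y c, l = a ++ (x :: b ++ y :: c) ∧ g x = g y
  | [], h => absurd List.nodup_nil h
  | x :: t, h => by
    by_cases hx : g x ∈ t.map g
    · obtain ⟨y, hy, hxy⟩ := List.mem_map.1 hx
      obtain ⟨b, c, rfl⟩ := List.append_of_mem hy
      exact ⟨[], x, b, y, c, rfl, hxy.symm⟩
    · have ht : ¬ (t.map g).Nodup := fun ht => h (List.nodup_cons.2 ⟨hx, ht⟩)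
      obtain ⟨a, z, b, y, c, rfl, hzy⟩ := exists_of_not_nodup_map g t ht
      exact ⟨x :: a, z, b, y, c, rfl, hzy⟩

namespace DirGraph

variable {E : DirGraph.{u, w}}

/-- Under Condition (L), not only the cycles but all closed paths have exits. -/
theorem ConditionL.exists_isExit (hL : E.ConditionL) {v : E.Vertex} {p : List E.Edge}
    (hp : E.IsPath v p v) (hne : p ≠ []) : ∃ f, E.IsExit f p := by
  induction hn : p.length using Nat.strong_induction_on generalizing v p with
  | _ n ih =>
    by_cases hd : (p.map E.s).Nodup
    · exact hL v p ⟨hne, hp, hd⟩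
    -- A repeated source cuts out the shorter closed path `e :: b`; its exit is also an exit of the
    -- whole path.
    · obtain ⟨a, e, b, f, c, rfl, hef⟩ := List.exists_of_not_nodup_map E.s p hd
      obtain ⟨y, -, hy⟩ := isPath_append.1 hp
      obtain ⟨z, hez, hz⟩ := isPath_append.1 hy
      obtain rfl : E.s e = y := hez.1
      obtain rfl : E.s f = z := hz.1
      rw [← hef] at hez
      obtain ⟨g, e', he', hg⟩ := ih _ (by simp at hn ⊢; omega) hez (by simp) rfl
      exact ⟨g, e', by simp only [List.mem_append]; exact Or.inr (Or.inl he'), hg⟩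

end DirGraph

namespace LeavittPathAlgebra

open DirGraph

section

variable {K : Type k} [Field K] {E : DirGraph.{u, w}} {A : Type x} [NonUnitalRing A]

/-- As `ρ` is only a ring homomorphism, the scalar is cancelled inside the algebra, by multiplying
with `c⁻¹ v`. -/
theorem map_smul_vtx_ne_zero {ρ : LeavittPathAlgebra K E →ₙ+* A} {v : E.Vertex}
    (hv : ρ (vtx K v) ≠ 0) {c : K} (hc : c ≠ 0) : ρ (c • vtx K v) ≠ 0 := by
  intro h
  apply hv
  have : vtx K v = (c⁻¹ • vtx K v) * (c • vtx K v) := by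
    rw [smul_mul_smul_comm, vtx_mul_self, inv_mul_cancel₀ hc, one_smul]
  rw [this, map_mul, h, mul_zero]

/-- A linear combination of a vertex, with a nonzero coefficient, and of closed paths of positive
length is not in the kernel of a homomorphism that does not kill any vertex. -/
theorem map_vtx_add_sum_closed_ne_zero (hL : E.ConditionL) {ρ : LeavittPathAlgebra K E →ₙ+* A}
    (hρ : ∀ v, ρ (vtx K v) ≠ 0) {ι : Type*} (S : Finset ι) (v : E.Vertex) (γ : ι → List E.Edge)
    {k : K} (c : ι → K) (hk : k ≠ 0) (hγ : ∀ i ∈ S, γ i ≠ [] ∧ E.IsPath v (γ i) v) :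
    ρ (k • vtx K v + ∑ i ∈ S, c i • pth K v (γ i)) ≠ 0 := by
  classical
  induction S using Finset.strongInduction generalizing v γ with
  | H S ih =>
    obtain rfl | ⟨i₀, hi₀⟩ := S.eq_empty_or_nonempty
    · simpa using map_smul_vtx_ne_zero (hρ v) hk
    · intro h
      -- Let `δ` follow `γ i₀` up to an exit and then take the exit `f`. Compressing to `δ* X δ`
      -- turns `v` into `r(f)` and each `γ i` into zero or a closed path of the same length at
      -- `r(f)`. The term of `i₀` dies, so the index set shrinks.
      obtain ⟨f, e, he, hfe, hne⟩ := hL.exists_isExit (hγ i₀ hi₀).2 (hγ i₀ hi₀).1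
      obtain ⟨p, q, hpq⟩ := List.append_of_mem he
      have hδ : E.IsPath v (p ++ [f]) (E.r f) := by
        have h1 := (hγ i₀ hi₀).2
        rw [hpq] at h1
        obtain ⟨y, hy, hy'⟩ := isPath_append.1 h1
        exact hy.append ⟨hfe.trans hy'.1, rfl⟩
      set δ := p ++ [f] with hδ_def
      have key : ∀ i ∈ S, (δ <+: γ i ++ δ → ((γ i ++ δ).drop δ.length ≠ [] ∧
            E.IsPath (E.r f) ((γ i ++ δ).drop δ.length) (E.r f))) ∧
          gpth K v δ * pth K v (γ i) * pth K v δ =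
            if δ <+: γ i ++ δ then pth K (E.r f) ((γ i ++ δ).drop δ.length) else 0 := by
        intro i hi
        obtain ⟨h1, h2⟩ := hγ i hi
        rw [mul_assoc, ← pth_append h2 hδ]
        have h3 := h2.append hδ
        have h4 : 0 < (γ i).length := List.length_pos_iff.2 h1
        split_ifs with hpre
        · obtain ⟨t, ht⟩ := hpre
          rw [← ht] at h3 ⊢
          rw [List.drop_left]
          have h5 := hδ.of_append h3
          refine ⟨fun _ => ⟨?_, h5⟩, gpth_mul_pth_append hδ h5⟩
          rintro rfl
          have := congrArg List.length ht
          simp only [List.append_nil, List.length_append] at this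
          omega
        · refine ⟨fun h => absurd h hpre, gpth_mul_pth_eq_zero hδ h3 hpre fun h => ?_⟩
          have := h.length_le
          simp only [List.length_append] at this
          omega
      have hi₀' : ¬ δ <+: γ i₀ ++ δ := by
        rw [hpq, hδ_def]
        intro h
        rw [List.append_assoc, List.prefix_append_right_inj] at h
        simp at h
        exact hne h
      refine ih (S.filter fun i => δ <+: γ i ++ δ) ?_ (E.r f)
        (fun i => (γ i ++ δ).drop δ.length) ?_ ?_
      · exact Finset.filter_ssubset.2 ⟨i₀, hi₀, hi₀'⟩
      · intro i hi
        obtain ⟨hi, hpre⟩ := Finset.mem_filter.1 hi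
        exact (key i hi).1 hpre
      · have hX : k • vtx K (E.r f) + ∑ i ∈ S.filter fun i => δ <+: γ i ++ δ,
            c i • pth K (E.r f) ((γ i ++ δ).drop δ.length) =
            gpth K v δ * (k • vtx K v + ∑ i ∈ S, c i • pth K v (γ i)) * pth K v δ := by
          rw [mul_add, add_mul, mul_smul_comm, gpth_mul_vtx hδ, smul_mul_assoc,
            gpth_mul_pth_self hδ, Finset.mul_sum, Finset.sum_mul, Finset.sum_filter]
          congr 1
          refine Finset.sum_congr rfl fun i hi => ?_
          rw [mul_smul_comm, smul_mul_assoc, (key i hi).2]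
          split_ifs <;> simp
        rw [hX, map_mul, map_mul, h, mul_zero, zero_mul]

/-- A nontrivial linear combination of paths is not in the kernel of a homomorphism that does not
kill any vertex. -/
theorem map_linearCombination_pth_ne_zero (hL : E.ConditionL) {ρ : LeavittPathAlgebra K E →ₙ+* A}
    (hρ : ∀ v, ρ (vtx K v) ≠ 0) {u v : E.Vertex} {f : List E.Edge →₀ K}
    (hf : f ∈ Finsupp.supported K K {p | E.IsPath u p v}) (hf0 : f ≠ 0) :
    ρ (Finsupp.linearCombination K (pth K u) f) ≠ 0 := by
  classical
  intro h
  have hf : ∀ p ∈ f.support, E.IsPath u p v := fun p hp => (Finsupp.mem_supported K f).1 hf hp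
  -- Multiplying by `p*` for a shortest `p` in the support turns `p` into `v` and every other path
  -- into zero or a closed path of positive length; minimality rules out proper prefixes of `p`.
  obtain ⟨p, hp, hmin⟩ := f.support.exists_min_image List.length
    (Finsupp.support_nonempty_iff.2 hf0)
  refine map_vtx_add_sum_closed_ne_zero hL hρ ((f.support.erase p).filter fun q => p <+: q) v
    (fun q => q.drop p.length) f (Finsupp.mem_support_iff.1 hp) ?_ ?_
  · intro q hq
    obtain ⟨hq, t, rfl⟩ := Finset.mem_filter.1 hq
    obtain ⟨hne, hq⟩ := Finset.mem_erase.1 hq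
    simp only [List.drop_left]
    exact ⟨fun ht => hne (by simp [ht]), (hf p hp).of_append (hf _ hq)⟩
  · have hX : f p • vtx K v + ∑ q ∈ (f.support.erase p).filter fun q => p <+: q,
        f q • pth K v (q.drop p.length) =
        gpth K u p * Finsupp.linearCombination K (pth K u) f := by
      rw [Finsupp.linearCombination_apply, Finsupp.sum, ← Finset.add_sum_erase _ _ hp, mul_add,
        mul_smul_comm, gpth_mul_pth_self (hf p hp), Finset.mul_sum, Finset.sum_filter]
      congr 1
      refine Finset.sum_congr rfl fun q hq => ?_
      obtain ⟨hne, hq⟩ := Finset.mem_erase.1 hq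
      rw [mul_smul_comm]
      split_ifs with hpre
      · obtain ⟨t, rfl⟩ := hpre
        rw [List.drop_left, gpth_mul_pth_append (hf p hp) ((hf p hp).of_append (hf _ hq))]
      · rw [gpth_mul_pth_eq_zero (hf p hp) (hf q hq) hpre, smul_zero]
        exact fun h => hne (h.eq_of_length_le (hmin q hq))
    rw [hX, map_mul, h, mul_zero]

variable (K) in
/-- The monomials `p q*` from `u` to `v` such that `q` has length less than `n`. -/
def boundedMonomials (n : ℕ) (u v : E.Vertex) : Set (LeavittPathAlgebra K E) :=
  {a | ∃ x p q, E.IsPath u p x ∧ E.IsPath v q x ∧ q.length < n ∧ a = pth K u p * gpth K v q}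

theorem boundedMonomials_mono {m n : ℕ} (h : m ≤ n) (u v : E.Vertex) :
    boundedMonomials K m u v ⊆ boundedMonomials K n u v := by
  rintro a ⟨x, p, q, hp, hq, hl, rfl⟩
  exact ⟨x, p, q, hp, hq, hl.trans_le h, rfl⟩

theorem mul_vtx_of_mem_span {n : ℕ} {u v : E.Vertex} {a : LeavittPathAlgebra K E}
    (ha : a ∈ Submodule.span K (boundedMonomials K n u v)) : a * vtx K v = a := by
  induction ha using Submodule.span_induction with
  | mem a ha =>
    obtain ⟨x, p, q, hp, hq, -, rfl⟩ := ha
    rw [mul_assoc, gpth_mul_vtx hq]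
  | zero => exact zero_mul _
  | add a b _ _ ha hb => rw [add_mul, ha, hb]
  | smul c a _ ha => rw [smul_mul_assoc, ha]

theorem exists_vtx_mul_mul_vtx_mem_span (u v : E.Vertex) (a : LeavittPathAlgebra K E) :
    ∃ n, vtx K u * a * vtx K v ∈ Submodule.span K (boundedMonomials K n u v) := by
  induction a using monomial_induction with
  | monomial u' v' x p q hp hq =>
    refine ⟨q.length + 1, ?_⟩
    by_cases hu : u = u'
    · by_cases hv : v' = v
      · subst hu hv
        refine Submodule.subset_span ⟨x, p, q, hp, hq, Nat.lt_succ_self _, ?_⟩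
        rw [← mul_assoc, vtx_mul_pth hp, mul_assoc, gpth_mul_vtx hq]
      · rw [← gpth_mul_vtx hq, mul_assoc, mul_assoc, mul_assoc (gpth K v' q), vtx_mul_of_ne hv]
        simp
    · rw [← vtx_mul_pth hp, ← mul_assoc, ← mul_assoc, vtx_mul_of_ne hu]
      simp
  | zero => exact ⟨0, by simp⟩
  | add a b ha hb =>
    obtain ⟨m, ha⟩ := ha
    obtain ⟨n, hb⟩ := hb
    refine ⟨max m n, ?_⟩
    rw [mul_add, add_mul]
    exact add_mem (Submodule.span_mono (boundedMonomials_mono (le_max_left m n) u v) ha)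
      (Submodule.span_mono (boundedMonomials_mono (le_max_right m n) u v) hb)
  | smul c a ha =>
    obtain ⟨n, ha⟩ := ha
    refine ⟨n, ?_⟩
    rw [mul_smul_comm, smul_mul_assoc]
    exact Submodule.smul_mem _ _ ha

/-- Finite sums of vertices are local units. Allowing every larger `F'` lets the sets for two
summands be joined. -/
theorem exists_sum_vtx_mul (a : LeavittPathAlgebra K E) :
    ∃ F : Finset E.Vertex, ∀ F', F ⊆ F' → (∑ v ∈ F', vtx K v) * a * ∑ v ∈ F', vtx K v = a := by
  classical
  induction a using monomial_induction with
  | monomial u v x p q hp hq =>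
    refine ⟨{u, v}, fun F' hF => ?_⟩
    have h1 : (∑ v ∈ F', vtx K v) * pth K u p = pth K u p := by
      rw [Finset.sum_mul, Finset.sum_eq_single u, vtx_mul_pth hp]
      · intro y _ hy
        rw [← vtx_mul_pth hp, ← mul_assoc, vtx_mul_of_ne hy, zero_mul]
      · exact fun h => absurd (hF (by simp)) h
    have h2 : gpth K v q * (∑ v ∈ F', vtx K v) = gpth K v q := by
      rw [Finset.mul_sum, Finset.sum_eq_single v, gpth_mul_vtx hq]
      · intro y _ hy
        rw [← gpth_mul_vtx hq, mul_assoc, vtx_mul_of_ne hy.symm, mul_zero]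
      · exact fun h => absurd (hF (by simp)) h
    rw [← mul_assoc, h1, mul_assoc, h2]
  | zero => exact ⟨∅, by simp⟩
  | add a b ha hb =>
    obtain ⟨F, ha⟩ := ha
    obtain ⟨G, hb⟩ := hb
    refine ⟨F ∪ G, fun F' h => ?_⟩
    rw [mul_add, add_mul, ha F' (Finset.union_subset_left h), hb F' (Finset.union_subset_right h)]
  | smul c a ha =>
    obtain ⟨F, ha⟩ := ha
    refine ⟨F, fun F' h => ?_⟩
    rw [mul_smul_comm, smul_mul_assoc, ha F' h]

theorem eq_zero_of_vtx_mul_mul_vtx (a : LeavittPathAlgebra K E)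
    (h : ∀ u v, vtx K u * a * vtx K v = 0) : a = 0 := by
  obtain ⟨F, hF⟩ := exists_sum_vtx_mul a
  rw [← hF F subset_rfl, Finset.sum_mul, Finset.sum_mul]
  refine Finset.sum_eq_zero fun u _ => ?_
  rw [Finset.mul_sum]
  exact Finset.sum_eq_zero fun v _ => h u v

theorem linearCombination_pth_mul_edg {u : E.Vertex} {e : E.Edge} {f : List E.Edge →₀ K}
    (hf : f ∈ Finsupp.supported K K {p | E.IsPath u p (E.s e)}) :
    Finsupp.linearCombination K (pth K u) f * edg K e =
      Finsupp.linearCombination K (pth K u) (f.mapDomain (· ++ [e])) := by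
  rw [Finsupp.linearCombination_mapDomain, Finsupp.linearCombination_apply,
    Finsupp.linearCombination_apply, Finsupp.sum, Finsupp.sum, Finset.sum_mul]
  refine Finset.sum_congr rfl fun p hp => ?_
  rw [smul_mul_assoc, Function.comp_apply,
    pth_append ((Finsupp.mem_supported K f).1 hf hp) isPath_singleton, pth_singleton]

theorem mapDomain_append_mem_supported {u : E.Vertex} {e : E.Edge} {f : List E.Edge →₀ K}
    (hf : f ∈ Finsupp.supported K K {p | E.IsPath u p (E.s e)}) :
    f.mapDomain (· ++ [e]) ∈ Finsupp.supported K K {p | E.IsPath u p (E.r e)} := by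
  classical
  refine (Finsupp.mem_supported K _).2 fun p hp => ?_
  obtain ⟨q, hq, rfl⟩ := Finset.mem_image.1 (Finsupp.mapDomain_support hp)
  exact IsPath.append ((Finsupp.mem_supported K f).1 hf hq) isPath_singleton

theorem linearCombination_pth_mem_span {n : ℕ} (hn : 0 < n) {u v : E.Vertex}
    {f : List E.Edge →₀ K} (hf : f ∈ Finsupp.supported K K {p | E.IsPath u p v}) :
    Finsupp.linearCombination K (pth K u) f ∈ Submodule.span K (boundedMonomials K n u v) := by
  rw [Finsupp.linearCombination_apply]
  refine Submodule.sum_mem _ fun p hp => Submodule.smul_mem _ _ (Submodule.subset_span ?_)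
  have hp := (Finsupp.mem_supported K f).1 hf hp
  exact ⟨v, p, [], hp, rfl, hn, (pth_mul_vtx hp).symm⟩

/-- An element with ghost paths of length at most `n` is the sum of a combination of real paths and
of terms ending in a ghost edge. -/
theorem exists_eq_linearCombination_add_sum {n : ℕ} {u v : E.Vertex} {a : LeavittPathAlgebra K E}
    (ha : a ∈ Submodule.span K (boundedMonomials K (n + 1) u v)) :
    ∃ f ∈ Finsupp.supported K K {p | E.IsPath u p v},
    ∃ (F : Finset E.Edge) (y : E.Edge → LeavittPathAlgebra K E), (∀ e ∈ F, E.s e = v) ∧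
      (∀ e, y e ∈ Submodule.span K (boundedMonomials K n u (E.r e))) ∧ (∀ e ∉ F, y e = 0) ∧
      a = Finsupp.linearCombination K (pth K u) f + ∑ e ∈ F, y e * gho K e := by
  classical
  induction ha using Submodule.span_induction with
  | mem a ha =>
    obtain ⟨x, p, q, hp, hq, hl, rfl⟩ := ha
    cases q with
    | nil =>
      obtain rfl : v = x := hq
      refine ⟨Finsupp.single p 1, ?_, ∅, 0, by simp, by simp, by simp, ?_⟩
      · exact Finsupp.single_mem_supported K 1 hp
      · simp [gpth, pth_mul_vtx hp]
    | cons e q =>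
      obtain ⟨rfl, hq⟩ := hq
      refine ⟨0, zero_mem _, {e}, Pi.single e (pth K u p * gpth K (E.r e) q), by simp, ?_, ?_, ?_⟩
      · intro e'
        by_cases h : e' = e
        · subst h
          rw [Pi.single_eq_same]
          exact Submodule.subset_span ⟨x, p, q, hp, hq, by simpa using hl, rfl⟩
        · rw [Pi.single_eq_of_ne h]
          exact zero_mem _
      · intro e' he'
        rw [Pi.single_eq_of_ne (by simpa using he')]
      · simp [gpth, mul_assoc]
  | zero => exact ⟨0, zero_mem _, ∅, 0, by simp, by simp, by simp, by simp⟩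
  | add a b _ _ ha hb =>
    obtain ⟨f, hf, F, y, h1, h2, h3, rfl⟩ := ha
    obtain ⟨g, hg, G, z, h1', h2', h3', rfl⟩ := hb
    refine ⟨f + g, add_mem hf hg, F ∪ G, y + z, ?_, fun e => add_mem (h2 e) (h2' e), ?_, ?_⟩
    · intro e he
      exact (Finset.mem_union.1 he).elim (h1 e) (h1' e)
    · intro e he
      rw [Finset.mem_union, not_or] at he
      rw [Pi.add_apply, h3 e he.1, h3' e he.2, add_zero]
    · have hF : ∑ e ∈ F, y e * gho K e = ∑ e ∈ F ∪ G, y e * gho K e :=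
        Finset.sum_subset Finset.subset_union_left fun e _ he => by rw [h3 e he, zero_mul]
      have hG : ∑ e ∈ G, z e * gho K e = ∑ e ∈ F ∪ G, z e * gho K e :=
        Finset.sum_subset Finset.subset_union_right fun e _ he => by rw [h3' e he, zero_mul]
      rw [map_add, hF, hG]
      simp only [Pi.add_apply, add_mul, Finset.sum_add_distrib]
      abel
  | smul c a _ ha =>
    obtain ⟨f, hf, F, y, h1, h2, h3, rfl⟩ := ha
    refine ⟨c • f, Submodule.smul_mem _ _ hf, F, c • y, h1,
      fun e => Submodule.smul_mem _ _ (h2 e), fun e he => ?_, ?_⟩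
    · rw [Pi.smul_apply, h3 e he, smul_zero]
    · simp [Finset.smul_sum, smul_mul_assoc]

/-- Induction on the ghost length. Write `a = f + ∑ y_e e*` with `f` a combination of real paths.
Then `a e = f e + y_e` is again in the kernel and has shorter ghost paths, so it vanishes by
induction; when every edge out of `v` occurs in the sum, (CK2) recovers `a` from the products `a e`.
-/
theorem eq_zero_of_mem_span_boundedMonomials (hL : E.ConditionL)
    {ρ : LeavittPathAlgebra K E →ₙ+* A} (hρ : ∀ v, ρ (vtx K v) ≠ 0) (n : ℕ) {u v : E.Vertex}
    {a : LeavittPathAlgebra K E} (ha : a ∈ Submodule.span K (boundedMonomials K n u v))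
    (h : ρ a = 0) : a = 0 := by
  classical
  induction n generalizing u v a with
  | zero =>
    have : boundedMonomials K 0 u v = ∅ :=
      Set.eq_empty_of_forall_notMem fun _ ⟨_, _, _, _, _, hl, _⟩ => Nat.not_lt_zero _ hl
    simpa [this] using ha
  | succ n ih =>
    obtain ⟨f, hf, F, y, h1, h2, h3, rfl⟩ := exists_eq_linearCombination_add_sum ha
    have hmul : ∀ e, E.s e = v → (Finsupp.linearCombination K (pth K u) f +
        ∑ e ∈ F, y e * gho K e) * edg K e =
        Finsupp.linearCombination K (pth K u) (f.mapDomain (· ++ [e])) + y e := by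
      rintro e rfl
      rw [add_mul, linearCombination_pth_mul_edg hf]
      congr 1
      rw [Finset.sum_mul, Finset.sum_eq_single e, mul_assoc, gho_mul_edg,
        mul_vtx_of_mem_span (h2 e)]
      · intro e' _ hne
        rw [mul_assoc, gho_mul_edg_of_ne hne, mul_zero]
      · intro he
        rw [h3 e he, zero_mul, zero_mul]
    by_cases hF : ∀ e ∈ F, y e = 0
    · rw [Finset.sum_eq_zero fun e he => by rw [hF e he, zero_mul], add_zero] at h ⊢
      by_contra hne
      exact map_linearCombination_pth_ne_zero hL hρ hf (fun h0 => hne (by simp [h0])) h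
    have hy : ∀ e ∈ F, Finsupp.linearCombination K (pth K u) 
        (f.mapDomain (· ++ [e])) + y e = 0 := by
      -- The real paths in `f e` need a positive length bound, so the bound `0` is treated apart:
      -- there every `y e` is zero, contrary to `hF`.
      cases n with
      | zero =>
        have hempty (e) : boundedMonomials K 0 u (E.r e) = ∅ :=
          Set.eq_empty_of_forall_notMem fun _ ⟨_, _, _, _, _, hl, _⟩ => Nat.not_lt_zero _ hl
        exact absurd (fun e _ => by simpa [hempty e] using h2 e) hF
      | succ n =>
        intro e he
        obtain rfl := h1 e he
        refine ih (add_mem (linearCombination_pth_mem_span n.succ_pos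
          (mapDomain_append_mem_supported hf)) (h2 e)) ?_
        rw [← hmul e rfl, map_mul, h, zero_mul]
    have hf0 : f ≠ 0 := by
      rintro rfl
      exact hF fun e he => by simpa using hy e he
    -- For an edge `e` out of `v` missing from `F`, the product `a e = f e` would be a nontrivial
    -- combination of real paths in the kernel.
    have hall : ∀ e, E.s e = v → e ∈ F := by
      rintro e rfl
      by_contra he
      refine map_linearCombination_pth_ne_zero hL hρ (mapDomain_append_mem_supported hf) ?_ ?_
      · rw [← Finsupp.mapDomain_zero (f := (· ++ [e]))]
        exact (Finsupp.mapDomain_injective (List.append_left_injective [e])).ne hf0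
      · have := hmul e rfl
        rw [h3 e he, add_zero] at this
        rw [← this, map_mul, h, zero_mul]
    have hset : {e | E.s e = v} = F := Set.ext fun e => ⟨hall e, h1 e⟩
    have hfin : {e | E.s e = v}.Finite := hset ▸ F.finite_toSet
    have hsum : vtx K v = ∑ e ∈ F, edg K e * gho K e := by
      have hne : {e | E.s e = v}.Nonempty := by
        push Not at hF
        obtain ⟨e, he, -⟩ := hF
        exact ⟨e, h1 e he⟩
      rw [vtx, (isLeavittFamily_gen K E).vertex_eq_sum v hne hfin]
      exact Finset.sum_congr (Finset.coe_injective (by simpa using hset)) fun _ _ => rfl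
    have hv : Finsupp.linearCombination K (pth K u) f * vtx K v =
        Finsupp.linearCombination K (pth K u) f :=
      mul_vtx_of_mem_span (linearCombination_pth_mem_span Nat.one_pos hf)
    -- By (CK2) at `v`, `a = ∑ (f e + y_e) e*`, and every bracket is zero.
    rw [← hv, hsum, Finset.mul_sum, ← Finset.sum_add_distrib]
    refine Finset.sum_eq_zero fun e he => ?_
    rw [← mul_assoc, ← add_mul]
    obtain rfl := h1 e he
    rw [linearCombination_pth_mul_edg hf, hy e he, zero_mul]

/-- The Cuntz–Krieger uniqueness theorem. -/
theorem injective_of_conditionL (hL : E.ConditionL) {ρ : LeavittPathAlgebra K E →ₙ+* A}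
    (hρ : ∀ v, ρ (vtx K v) ≠ 0) {a : LeavittPathAlgebra K E} (ha : ρ a = 0) : a = 0 := by
  refine eq_zero_of_vtx_mul_mul_vtx a fun u v => ?_
  obtain ⟨n, hn⟩ := exists_vtx_mul_mul_vtx_mem_span u v a
  refine eq_zero_of_mem_span_boundedMonomials hL hρ n hn ?_
  rw [map_mul, map_mul, ha, mul_zero, zero_mul]

end

end LeavittPathAlgebra

/-! ### Necessity of the three conditions -/

section SimpleModule

variable {R : Type*} [NonUnitalRing R] {M : Type*} [AddCommGroup M] {ρ : R →ₙ+* AddMonoid.End M}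

theorem map_mul_apply (ρ : R →ₙ+* AddMonoid.End M) (a b : R) (m : M) :
    ρ (a * b) m = ρ a (ρ b m) := by
  rw [map_mul]
  rfl

theorem map_sub_apply (ρ : R →ₙ+* AddMonoid.End M) (a b : R) (m : M) :
    ρ (a - b) m = ρ a m - ρ b m := by
  rw [map_sub]
  rfl

theorem map_add_apply (ρ : R →ₙ+* AddMonoid.End M) (a b : R) (m : M) :
    ρ (a + b) m = ρ a m + ρ b m := by
  rw [map_add]
  rfl

/-- In a simple module, an element that is not annihilated by the ring is a generator. -/
theorem exists_apply_eq_of_simple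
    (hs : ∀ N : AddSubgroup M, (∀ (a : R), ∀ m ∈ N, ρ a m ∈ N) → N = ⊥ ∨ N = ⊤)
    {a : R} {m : M} (h : ρ a m ≠ 0) (m' : M) : ∃ b, ρ b m = m' := by
  let φ : R →+ M := (AddMonoidHom.eval m).comp (ρ : R →+ AddMonoid.End M)
  have hφ : ∀ b, φ b = ρ b m := fun _ => rfl
  rcases hs φ.range (by
    rintro b _ ⟨c, rfl⟩
    exact ⟨b * c, map_mul_apply ρ b c m⟩) with h0 | h1
  · have : ρ a m ∈ φ.range := ⟨a, rfl⟩
    rw [h0] at this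
    exact absurd this h
  · have : m' ∈ φ.range := by rw [h1]; trivial
    exact this

theorem exists_apply_ne_zero (hf : ∀ a : R, (∀ m : M, ρ a m = 0) → a = 0) {a : R} (ha : a ≠ 0) :
    ∃ m, ρ a m ≠ 0 := by
  by_contra! h
  exact ha (hf a h)

end SimpleModule

namespace DirGraph

variable {E : DirGraph.{u, w}} {H : Set E.Vertex}

theorem IsPath.range_mem (hH : ∀ e, E.s e ∈ H → E.r e ∈ H ∧ ∀ f, E.s f = E.s e → f = e)
    {u x : E.Vertex} (hu : u ∈ H) {p : List E.Edge} (hp : E.IsPath u p x) : x ∈ H := by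
  induction p generalizing u with
  | nil =>
    obtain rfl : u = x := hp
    exact hu
  | cons e p ih =>
    obtain ⟨rfl, hp⟩ := hp
    exact ih (hH e hu).1 hp

/-- In `H` each vertex emits at most one edge and edges stay in `H`, so a path from `u` is
determined by its length. -/
theorem IsPath.prefix_of_length_le
    (hH : ∀ e, E.s e ∈ H → E.r e ∈ H ∧ ∀ f, E.s f = E.s e → f = e)
    {u x y : E.Vertex} (hu : u ∈ H) {p q : List E.Edge} (hp : E.IsPath u p x)
    (hq : E.IsPath u q y) (hl : p.length ≤ q.length) : p <+: q := by
  induction p generalizing u q with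
  | nil => simp
  | cons e p ih =>
    cases q with
    | nil => simp at hl
    | cons f q =>
      obtain ⟨rfl, hp⟩ := hp
      obtain rfl := (hH e hu).2 f hq.1
      rw [List.prefix_cons_inj]
      exact ih (hH f hu).1 hp hq.2 (by simpa using hl)

/-- For a closed path this makes the set of sources of its edges closed under following those edges.
-/
theorem IsPath.range_mem_sources {v : E.Vertex} {c : List E.Edge} :
    ∀ {u : E.Vertex}, E.IsPath u c v → ∀ e ∈ c, E.r e = v ∨ ∃ f ∈ c, E.s f = E.r e := by
  induction c with
  | nil => simp
  | cons e c ih =>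
    intro u hc e' he'
    rcases List.mem_cons.1 he' with rfl | he'
    · cases c with
      | nil => exact Or.inl hc.2
      | cons f c => exact Or.inr ⟨f, by simp, hc.2.1⟩
    · rcases ih hc.2 e' he' with h | ⟨f, hf, h⟩
      · exact Or.inl h
      · exact Or.inr ⟨f, List.mem_cons_of_mem _ hf, h⟩

end DirGraph

namespace LeavittPathAlgebra

open DirGraph

section

variable {K : Type k} [Field K] {E : DirGraph.{u, w}}

/-- A monomial `p q*` surviving between `v` and `v'` has `r(p) = r(q)` as a common descendant of
both. -/
theorem vtx_mul_mul_vtx_eq_zero {v v' : E.Vertex}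
    (h : ∀ x, E.Reaches v x → ¬ E.Reaches v' x) (a : LeavittPathAlgebra K E) :
    vtx K v * a * vtx K v' = 0 := by
  induction a using monomial_induction with
  | monomial u u' x p q hp hq =>
    by_cases hu : v = u
    · by_cases hu' : u' = v'
      · subst hu hu'
        exact absurd ⟨q, hq⟩ (h x ⟨p, hp⟩)
      · rw [← gpth_mul_vtx hq, mul_assoc, mul_assoc, mul_assoc (gpth K u' q), vtx_mul_of_ne hu']
        simp
    · rw [← vtx_mul_pth hp, ← mul_assoc, ← mul_assoc, vtx_mul_of_ne hu]
      simp
  | zero => simp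
  | add a b ha hb => rw [mul_add, add_mul, ha, hb, add_zero]
  | smul c a ha => rw [mul_smul_comm, smul_mul_assoc, ha, smul_zero]

theorem conditionMT3_of_isLeftPrimitive (h : IsLeftPrimitive (LeavittPathAlgebra K E)) :
    E.ConditionMT3 := by
  obtain ⟨M, _, ρ, -, hs, hf⟩ := h
  intro v v'
  by_contra! hvv
  obtain ⟨m, hm⟩ := exists_apply_ne_zero hf (vtx_ne_zero K v')
  have hm' : ρ (vtx K v') (ρ (vtx K v') m) ≠ 0 := by
    rwa [← map_mul_apply, vtx_mul_self]
  refine vtx_ne_zero K v (hf _ fun m' => ?_)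
  obtain ⟨b, rfl⟩ := exists_apply_eq_of_simple hs hm' m'
  rw [← map_mul_apply, ← map_mul_apply,
    vtx_mul_mul_vtx_eq_zero hvv, map_zero]
  rfl

/-! ### Regions without branching -/

section Unbranched

variable {H : Set E.Vertex}

/-- At a vertex emitting exactly one edge `e`, (CK2) reads `s(e) = e e*`. -/
theorem pth_mul_gpth_self
    (hH : ∀ e, E.s e ∈ H → E.r e ∈ H ∧ ∀ f, E.s f = E.s e → f = e)
    {u x : E.Vertex} (hu : u ∈ H) {p : List E.Edge} (hp : E.IsPath u p x) :
    pth K u p * gpth K u p = vtx K u := by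
  induction p generalizing u with
  | nil => exact vtx_mul_self u
  | cons e p ih =>
    obtain ⟨rfl, hp⟩ := hp
    have hset : {f | E.s f = E.s e} = {e} := Set.ext fun f => ⟨(hH e hu).2 f, fun h => h ▸ rfl⟩
    have hfin : {f | E.s f = E.s e}.Finite := hset ▸ Set.finite_singleton e
    have hsum := (isLeavittFamily_gen K E).vertex_eq_sum (E.s e) ⟨e, rfl⟩ hfin
    have hF : hfin.toFinset = {e} := Finset.coe_injective (by simpa using hset)
    rw [hF, Finset.sum_singleton] at hsum
    rw [pth, gpth, mul_assoc, ← mul_assoc (pth K _ p), ih (hH e hu).1 hp, vtx_mul_gho]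
    exact hsum.symm

/-- Only the degree `|p| - |q|` matters: `p'` and `q'` extend `p` and `q` by the same path `t`, and
`t t*` is a vertex. -/
theorem pth_mul_gpth_eq_of_le
    (hH : ∀ e, E.s e ∈ H → E.r e ∈ H ∧ ∀ f, E.s f = E.s e → f = e)
    {u x x' : E.Vertex} (hu : u ∈ H) {p q p' q' : List E.Edge} (hp : E.IsPath u p x)
    (hq : E.IsPath u q x) (hp' : E.IsPath u p' x') (hq' : E.IsPath u q' x')
    (hl : p.length + q'.length = p'.length + q.length) (hle : p.length ≤ p'.length) :
    pth K u p * gpth K u q = pth K u p' * gpth K u q' := by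
  obtain ⟨t, rfl⟩ := IsPath.prefix_of_length_le hH hu hp hp' hle
  obtain ⟨t', rfl⟩ := IsPath.prefix_of_length_le hH hu hq hq' (by omega)
  have ht := hp.of_append hp'
  have ht' := hq.of_append hq'
  have hx := IsPath.range_mem hH hu hp
  obtain rfl : t = t' :=
    (IsPath.prefix_of_length_le hH hx ht ht' (by simp at hl; omega)).eq_of_length
      (by simp at hl; omega)
  rw [pth_append hp ht, gpth_append hq ht, mul_assoc, ← mul_assoc (pth K x t),
    pth_mul_gpth_self hH hx ht, vtx_mul_gpth hq]

theorem pth_mul_gpth_eq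
    (hH : ∀ e, E.s e ∈ H → E.r e ∈ H ∧ ∀ f, E.s f = E.s e → f = e)
    {u x x' : E.Vertex} (hu : u ∈ H) {p q p' q' : List E.Edge} (hp : E.IsPath u p x)
    (hq : E.IsPath u q x) (hp' : E.IsPath u p' x') (hq' : E.IsPath u q' x')
    (hl : p.length + q'.length = p'.length + q.length) :
    pth K u p * gpth K u q = pth K u p' * gpth K u q' := by
  rcases le_total p.length p'.length with h | h
  · exact pth_mul_gpth_eq_of_le hH hu hp hq hp' hq' hl h
  · exact (pth_mul_gpth_eq_of_le hH hu hp' hq' hp hq hl.symm h).symm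

/-- Degrees add under multiplication, which together with `pth_mul_gpth_eq` makes the corner
commutative. The equation of lengths is arranged to avoid subtraction. -/
theorem exists_mul_monomial_eq
    (hH : ∀ e, E.s e ∈ H → E.r e ∈ H ∧ ∀ f, E.s f = E.s e → f = e)
    {u x x' : E.Vertex} (hu : u ∈ H) {p q p' q' : List E.Edge} (hp : E.IsPath u p x)
    (hq : E.IsPath u q x) (hp' : E.IsPath u p' x') (hq' : E.IsPath u q' x') :
    ∃ y P Q, E.IsPath u P y ∧ E.IsPath u Q y ∧
      P.length + (q.length + q'.length) = Q.length + (p.length + p'.length) ∧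
      (pth K u p * gpth K u q) * (pth K u p' * gpth K u q') = pth K u P * gpth K u Q := by
  rcases le_total q.length p'.length with h | h
  · obtain ⟨t, rfl⟩ := IsPath.prefix_of_length_le hH hu hq hp' h
    have ht := hq.of_append hp'
    refine ⟨x', p ++ t, q', hp.append ht, hq', by simp; omega, ?_⟩
    rw [mul_assoc, ← mul_assoc (gpth K u q), gpth_mul_pth_append hq ht, pth_append hp ht, mul_assoc]
  · obtain ⟨t, rfl⟩ := IsPath.prefix_of_length_le hH hu hp' hq h
    have ht := hp'.of_append hq
    refine ⟨x, p, q' ++ t, hp, hq'.append ht, by simp; omega, ?_⟩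
    rw [mul_assoc, ← mul_assoc (gpth K u _), gpth_append_mul_pth hp' ht, gpth_append hq' ht]

theorem vtx_mul_mul_vtx_induction {v : E.Vertex} {P : LeavittPathAlgebra K E → Prop}
    (a : LeavittPathAlgebra K E)
    (monomial : ∀ x p q, E.IsPath v p x → E.IsPath v q x → P (pth K v p * gpth K v q))
    (zero : P 0) (add : ∀ a b, P a → P b → P (a + b)) (smul : ∀ (c : K) a, P a → P (c • a)) :
    P (vtx K v * a * vtx K v) := by
  obtain ⟨n, hn⟩ := exists_vtx_mul_mul_vtx_mem_span v v a
  generalize vtx K v * a * vtx K v = a at hn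
  induction hn using Submodule.span_induction with
  | mem a ha =>
    obtain ⟨x, p, q, hp, hq, -, rfl⟩ := ha
    exact monomial x p q hp hq
  | zero => exact zero
  | add a b _ _ ha hb => exact add a b ha hb
  | smul c a _ ha => exact smul c a ha

/-- The corner at a vertex of a region without branching is commutative. -/
theorem corner_commute (hH : ∀ e, E.s e ∈ H → E.r e ∈ H ∧ ∀ f, E.s f = E.s e → f = e)
    {v : E.Vertex} (hv : v ∈ H) (a b : LeavittPathAlgebra K E) :
    (vtx K v * a * vtx K v) * (vtx K v * b * vtx K v) =
      (vtx K v * b * vtx K v) * (vtx K v * a * vtx K v) := by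
  refine vtx_mul_mul_vtx_induction
    (P := fun a => a * (vtx K v * b * vtx K v) = (vtx K v * b * vtx K v) * a) a ?_ ?_ ?_ ?_
  · intro x p q hp hq
    refine vtx_mul_mul_vtx_induction
      (P := fun b => pth K v p * gpth K v q * b = b * (pth K v p * gpth K v q)) b ?_ ?_ ?_ ?_
    · intro x' p' q' hp' hq'
      obtain ⟨y, P, Q, hP, hQ, hl, h⟩ := exists_mul_monomial_eq (K := K) hH hv hp hq hp' hq'
      obtain ⟨y', P', Q', hP', hQ', hl', h'⟩ := exists_mul_monomial_eq (K := K) hH hv hp' hq' hp hq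
      rw [h, h']
      exact pth_mul_gpth_eq hH hv hP hQ hP' hQ' (by omega)
    · simp
    · intro a b ha hb
      rw [mul_add, add_mul, ha, hb]
    · intro c a ha
      rw [mul_smul_comm, smul_mul_assoc, ha]
  · simp
  · intro a b ha hb
    rw [mul_add, add_mul, ha, hb]
  · intro c a ha
    rw [mul_smul_comm, smul_mul_assoc, ha]

end Unbranched

theorem conditionL_of_isLeftPrimitive (h : IsLeftPrimitive (LeavittPathAlgebra K E)) :
    E.ConditionL := by
  obtain ⟨M, _, ρ, -, hs, hf⟩ := h
  rintro v c ⟨hne, hc, -⟩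
  by_contra! hex
  have hsole : ∀ e ∈ c, ∀ f, E.s f = E.s e → f = e := fun e he f hfe => by
    by_contra hfe'
    exact hex f ⟨e, he, hfe, hfe'⟩
  obtain ⟨e₀, he₀, hv⟩ : ∃ e ∈ c, E.s e = v := by
    cases c with
    | nil => exact absurd rfl hne
    | cons e c => exact ⟨e, by simp, hc.1⟩
  have hH : ∀ e, E.s e ∈ {u | ∃ e ∈ c, E.s e = u} →
      E.r e ∈ {u | ∃ e ∈ c, E.s e = u} ∧ ∀ f, E.s f = E.s e → f = e := by
    rintro e ⟨e', he', hee⟩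
    obtain rfl := hsole e' he' e hee.symm
    refine ⟨?_, hsole e he'⟩
    rcases IsPath.range_mem_sources hc e he' with h | h
    · exact ⟨e₀, he₀, hv.trans h.symm⟩
    · exact h
  have comm := corner_commute (K := K) hH (v := v) ⟨e₀, he₀, hv⟩
  obtain ⟨τ, hτ⟩ := exists_shift_representation K E
  have hτv (f y) : τ (vtx K v) f (v, y) = f (v, y) := by
    have := hτ v v [] rfl (by simp) f y
    have hy : Sum.map id (· + (([] : List E.Edge).length : ℤ)) y = y := by cases y <;> simp
    rwa [hy] at this
  have hτc := hτ v v c hc hsole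
  set d : LeavittPathAlgebra K E := vtx K v - pth K v c with hd
  have hvd : vtx K v * d = d := by rw [hd, mul_sub, vtx_mul_self, vtx_mul_pth hc]
  have hdv : d * vtx K v = d := by rw [hd, sub_mul, vtx_mul_self, pth_mul_vtx hc]
  have hd0 : d ≠ 0 := by
    intro h0
    classical
    -- On the summand `ℤ`, `c` moves the point mass at `0` to the position `|c| ≠ 0`, so it does not
    -- act as `v`.
    have h1 := hτc (Pi.single (v, Sum.inr 0) 1) (Sum.inr 0)
    rw [← sub_eq_zero.1 (hd.symm.trans h0), Sum.map_inr, hτv] at h1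
    simp [hne] at h1
  obtain ⟨m, hm⟩ := exists_apply_ne_zero hf hd0
  have hm' : ρ (vtx K v) (ρ d m) ≠ 0 := by
    rwa [← map_mul_apply, hvd]
  obtain ⟨b, hb⟩ := exists_apply_eq_of_simple hs hm' (ρ (vtx K v) m)
  set a := vtx K v * b * vtx K v with ha
  have had : a * d = vtx K v * b * d := by rw [ha, mul_assoc, hvd]
  have hcorner : vtx K v * d * vtx K v = d := by rw [hvd, hdv]
  have hvm : ρ d (ρ (vtx K v) m) ≠ 0 := by
    rwa [← map_mul_apply, hdv]
  -- The element `z = a d - v` kills `m` and commutes with the corner, and `M = L v m`; hence `z x v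
  -- m = (v x v) z m = 0` for all `x`, and faithfulness applies.
  have hz : a * d - vtx K v = 0 := by
    refine hf _ fun m' => ?_
    obtain ⟨x, rfl⟩ := exists_apply_eq_of_simple hs hvm m'
    have hz1 : vtx K v * (a * d - vtx K v) * vtx K v = a * d - vtx K v := by
      rw [mul_sub, sub_mul, vtx_mul_self, vtx_mul_self, had]
      simp only [mul_assoc, hdv]
      rw [← mul_assoc (vtx K v) (vtx K v), vtx_mul_self]
    have hzm : ρ (a * d - vtx K v) m = 0 := by
      rw [map_sub_apply, had, mul_assoc, map_mul_apply, map_mul_apply, hb, ← map_mul_apply,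
        vtx_mul_self, sub_self]
    have hcomm := comm (a * d - vtx K v) x
    rw [hz1] at hcomm
    have hzx : (a * d - vtx K v) * (x * vtx K v) =
        (vtx K v * x * vtx K v) * (a * d - vtx K v) := by
      rw [← hcomm, ← hz1]
      simp only [mul_assoc]
      rw [← mul_assoc (vtx K v) (vtx K v) (x * _), vtx_mul_self]
    rw [← map_mul_apply, ← map_mul_apply, mul_assoc, hzx, map_mul_apply, hzm, map_zero]
  have hda : d * a = vtx K v := by
    have := comm b d
    rw [hcorner, ← ha] at this
    rw [← this]
    exact sub_eq_zero.1 hz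
  -- The point `Sum.inl e₀` is fixed by the shift, so at `(v, Sum.inl e₀)` any function of the form
  -- `d g` takes the value `0`; but `d a = v` takes the constant function `1` to a function with
  -- value `1` there.
  have h1 := hτv (fun _ => 1) (Sum.inl e₀)
  have h2 := hτc (τ a fun _ => 1) (Sum.inl e₀)
  rw [Sum.map_inl, id] at h2
  rw [← hda, map_mul, Module.End.mul_apply, hd, map_sub, LinearMap.sub_apply, Pi.sub_apply, hτv, h2,
    sub_self] at h1
  exact zero_ne_one h1

/-! ### The Countable Separation Property -/

/-- Write `a` in monomials; `A` collects the real parts `p` of those running from `v` to `w`. A path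
incomparable with all of them is killed by `q* p = 0`. -/
theorem exists_finset_comparable (v w : E.Vertex) (a : LeavittPathAlgebra K E) :
    ∃ A : Finset (List E.Edge), (∀ p ∈ A, ∃ x, E.IsPath v p x ∧ E.Reaches w x) ∧
      ∀ q x, E.IsPath v q x → (∀ p ∈ A, ¬ p <+: q ∧ ¬ q <+: p) →
        gpth K v q * a * vtx K w = 0 := by
  classical
  induction a using monomial_induction with
  | monomial u u' x p q hp hq =>
    by_cases hu : v = u
    · by_cases hu' : u' = w
      · subst hu hu'
        refine ⟨{p}, by simpa using ⟨x, hp, q, hq⟩, fun q' x' hq' h => ?_⟩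
        obtain ⟨h1, h2⟩ := h p (by simp)
        rw [← mul_assoc, gpth_mul_pth_eq_zero hq' hp h2 h1, zero_mul, zero_mul]
      · refine ⟨∅, by simp, fun q' x' hq' _ => ?_⟩
        rw [← gpth_mul_vtx hq, mul_assoc, mul_assoc, mul_assoc (gpth K u' q), vtx_mul_of_ne hu']
        simp
    · refine ⟨∅, by simp, fun q' x' hq' _ => ?_⟩
      rw [← gpth_mul_vtx hq', ← vtx_mul_pth hp, mul_assoc (vtx K u), mul_assoc (gpth K v q'),
        ← mul_assoc (vtx K v), vtx_mul_of_ne hu]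
      simp
  | zero => exact ⟨∅, by simp, by simp⟩
  | add a b ha hb =>
    obtain ⟨A, hA, hA'⟩ := ha
    obtain ⟨B, hB, hB'⟩ := hb
    refine ⟨A ∪ B, fun p hp => (Finset.mem_union.1 hp).elim (hA p) (hB p), fun q x hq h => ?_⟩
    rw [mul_add, add_mul, hA' q x hq fun p hp => h p (Finset.mem_union_left _ hp),
      hB' q x hq fun p hp => h p (Finset.mem_union_right _ hp), add_zero]
  | smul c a ha =>
    obtain ⟨A, hA, hA'⟩ := ha
    refine ⟨A, hA, fun q x hq h => ?_⟩
    rw [mul_smul_comm, smul_mul_assoc, hA' q x hq h, smul_zero]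

theorem vtx_mul_apply_eq_zero {M : Type*} [AddCommGroup M]
    {ρ : LeavittPathAlgebra K E →ₙ+* AddMonoid.End M} {v w : E.Vertex} {m : M}
    (h : ∀ q x, E.IsPath v q x → E.Reaches w x → ρ (gpth K v q) m = 0)
    (a : LeavittPathAlgebra K E) : ρ (vtx K w * a * vtx K v) m = 0 := by
  obtain ⟨n, hn⟩ := exists_vtx_mul_mul_vtx_mem_span w v a
  -- `M` carries no scalar action, so a further factor `w` is split off to absorb coefficients.
  rw [show vtx K w * a * vtx K v = vtx K w * (vtx K w * a * vtx K v) by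
    rw [← mul_assoc, ← mul_assoc, vtx_mul_self]]
  generalize vtx K w * a * vtx K v = a at hn
  induction hn using Submodule.span_induction with
  | mem a ha =>
    obtain ⟨x, p, q, hp, hq, -, rfl⟩ := ha
    rw [← mul_assoc, map_mul_apply, h q x hq ⟨p, hp⟩, map_zero]
  | zero => rw [mul_zero, map_zero]; rfl
  | add a b _ _ ha hb => rw [mul_add, map_add_apply, ha, hb, add_zero]
  | smul c a _ ha =>
    rw [show vtx K w * (c • a) = (c • vtx K w) * (vtx K w * a) by
      rw [← mul_assoc, smul_mul_assoc, vtx_mul_self, smul_mul_assoc, mul_smul_comm],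
      map_mul_apply, ha, map_zero]

theorem hasCSP_of_isLeftPrimitive [Nonempty E.Vertex]
    (h : IsLeftPrimitive (LeavittPathAlgebra K E)) : E.HasCSP Set.univ := by
  classical
  obtain ⟨M, _, ρ, -, hs, hf⟩ := h
  obtain ⟨v⟩ := ‹Nonempty E.Vertex›
  obtain ⟨m₀, hm₀⟩ := exists_apply_ne_zero hf (vtx_ne_zero K v)
  set m := ρ (vtx K v) m₀ with hm_def
  have hvm : ρ (vtx K v) m = m := by
    rw [hm_def, ← map_mul_apply, vtx_mul_self]
  let B : Set (List E.Edge) := {q | (∃ x, E.IsPath v q x) ∧ ρ (gpth K v q) m ≠ 0}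
  have key : ∀ w : E.Vertex, ∃ m₁ : M, ρ (vtx K w) m₁ ≠ 0 ∧ ρ (vtx K w) m₁ = m₁ := fun w => by
    obtain ⟨m₁, hm₁⟩ := exists_apply_ne_zero hf (vtx_ne_zero K w)
    have : ρ (vtx K w) (ρ (vtx K w) m₁) = ρ (vtx K w) m₁ := by
      rw [← map_mul_apply, vtx_mul_self]
    exact ⟨_, by rwa [this], this⟩
  -- Otherwise `w L v` annihilates `m = v m`, although `L m = M` contains a nonzero `m₁ = w m₁`.
  have hB1 : ∀ w, ∃ q ∈ B, ∃ x, E.IsPath v q x ∧ E.Reaches w x := by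
    intro w
    by_contra! hcon
    obtain ⟨m₁, h1, h2⟩ := key w
    obtain ⟨b, hb⟩ := exists_apply_eq_of_simple hs (hvm.symm ▸ hm₀) m₁
    refine h1 ?_
    rw [← hb, ← hvm, ← map_mul_apply, ← map_mul_apply, vtx_mul_apply_eq_zero]
    intro q x hq hw
    by_contra hne
    exact hcon q ⟨⟨x, hq⟩, hne⟩ x hq hw
  -- Write `m = b m₁` with `m₁ = w m₁`. Then `q* m = q* b w m₁` vanishes unless `q` is comparable
  -- with one of the finitely many paths attached to `b`.
  have hB2 : ∀ w, ∃ A : Finset (List E.Edge), (∀ p ∈ A, ∃ x, E.IsPath v p x ∧ E.Reaches w x) ∧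
      ∀ q ∈ B, ∃ p ∈ A, p <+: q ∨ q <+: p := by
    intro w
    obtain ⟨m₁, h1, h2⟩ := key w
    obtain ⟨b, hb⟩ := exists_apply_eq_of_simple hs h1 m
    obtain ⟨A, hA, hA'⟩ := exists_finset_comparable v w b
    refine ⟨A, hA, fun q hq => ?_⟩
    by_contra! hcon
    obtain ⟨⟨x, hqx⟩, hqm⟩ := hq
    refine hqm ?_
    rw [← hb, ← h2, ← map_mul_apply, ← map_mul_apply,
      hA' q x hqx hcon, map_zero]
    rfl
  by_cases hinf : ∃ q ∈ B, {e | q ++ [e] ∈ B}.Infinite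
  · obtain ⟨q, ⟨⟨x, hq⟩, -⟩, hinf⟩ := hinf
    refine ⟨{x}, Set.countable_singleton x, fun w _ => ⟨x, rfl, ?_⟩⟩
    obtain ⟨A, hA, hA'⟩ := hB2 w
    by_cases hpre : ∃ p ∈ A, p <+: q
    · obtain ⟨p, hp, t, rfl⟩ := hpre
      obtain ⟨y, hy, hw⟩ := hA p hp
      exact hw.trans ⟨t, hy.of_append hq⟩
    · push Not at hpre
      refine absurd ?_ hinf
      -- If no `p` in `A` is a prefix of `q`, each `q e` in `B` is a prefix of some `p` in `A`, so
      -- `e` is the entry of `p` at index `q.length`: finitely many choices.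
      refine Set.Finite.subset (Set.Finite.preimage (Option.some_injective _).injOn
        (A.image fun p => p[q.length]?).finite_toSet) fun e he => ?_
      obtain ⟨p, hp, h⟩ := hA' _ he
      have hqp : q ++ [e] <+: p := by
        rcases h with h | h
        · rcases List.prefix_concat_iff.1 h with h | h
          · rw [h]
          · exact absurd h (hpre p hp)
        · exact h
      obtain ⟨t, rfl⟩ := hqp
      rw [Set.mem_preimage, Finset.mem_coe, Finset.mem_image]
      exact ⟨_, hp, by simp⟩
  · push Not at hinf
    have hBn : ∀ n, {q | q ∈ B ∧ q.length = n}.Finite := by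
      intro n
      induction n with
      | zero =>
        refine (Set.finite_singleton []).subset ?_
        rintro q ⟨-, hq⟩
        exact List.length_eq_zero_iff.1 hq
      | succ n ih =>
        refine (ih.biUnion fun q hq => (hinf q hq.1).image fun e => q ++ [e]).subset ?_
        rintro q ⟨hq, hl⟩
        obtain rfl | ⟨p, e, rfl⟩ := List.eq_nil_or_concat q
        · simp at hl
        rw [List.concat_eq_append] at hl hq ⊢
        obtain ⟨⟨x, hx⟩, hm⟩ := hq
        obtain ⟨y, hp, he⟩ := isPath_append.1 hx
        -- `B` is closed under prefixes, because `(p e)* m = e* p* m`.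
        have hpB : p ∈ B := by
          refine ⟨⟨y, hp⟩, fun h0 => hm ?_⟩
          rw [gpth_append hp he, map_mul_apply, h0, map_zero]
        exact Set.mem_biUnion (x := p) ⟨hpB, by simpa using hl⟩ ⟨e, ⟨⟨x, hx⟩, hm⟩, rfl⟩
    have hBc : B.Countable := by
      refine (Set.countable_iUnion fun n => (hBn n).countable).mono fun q hq => ?_
      exact Set.mem_iUnion.2 ⟨q.length, hq, rfl⟩
    refine ⟨⋃ q ∈ B, {x | E.IsPath v q x}, hBc.biUnion fun q _ => ?_, fun w _ => ?_⟩
    · exact Set.Subsingleton.countable fun x hx y hy => IsPath.range_unique hx hy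
    · obtain ⟨q, hq, x, hx, hw⟩ := hB1 w
      exact ⟨x, Set.mem_biUnion hq hx, hw⟩

end

end LeavittPathAlgebra

/-! ### Sufficiency: a faithful simple quotient -/

section Modular

variable {R : Type x} [NonUnitalRing R]

/-- A proper modular left ideal is contained in a maximal one, whose quotient is a simple
module. -/
theorem exists_simple_quotient (N : AddSubgroup R) (hN : ∀ a, ∀ b ∈ N, a * b ∈ N) {e : R}
    (he : e ∉ N) (hmod : ∀ a, a - a * e ∈ N) :
    ∃ P : AddSubgroup R, N ≤ P ∧ e ∉ P ∧ (∀ a, ∀ b ∈ P, a * b ∈ P) ∧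
      ∀ Q : AddSubgroup R, (∀ a, ∀ b ∈ Q, a * b ∈ Q) → P ≤ Q → Q = P ∨ Q = ⊤ := by
  obtain ⟨P, hNP, hP⟩ := zorn_le_nonempty₀
    {P : AddSubgroup R | N ≤ P ∧ e ∉ P ∧ ∀ a, ∀ b ∈ P, a * b ∈ P} (by
      rintro c hc hchain P₀ hP₀
      have hmem : ∀ x, x ∈ sSup c ↔ ∃ P ∈ c, x ∈ P := fun x =>
        AddSubgroup.mem_sSup_of_directedOn ⟨P₀, hP₀⟩ hchain.directedOn
      refine ⟨sSup c, ⟨(hc hP₀).1.trans (le_sSup hP₀), fun h => ?_, fun a b hb => ?_⟩,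
        fun P hP => le_sSup hP⟩
      · obtain ⟨P, hP, he⟩ := (hmem e).1 h
        exact (hc hP).2.1 he
      · obtain ⟨P, hP, hb⟩ := (hmem b).1 hb
        exact (hmem _).2 ⟨P, hP, (hc hP).2.2 a b hb⟩) N ⟨le_rfl, he, hN⟩
  refine ⟨P, hNP, hP.prop.2.1, hP.prop.2.2, fun Q hQ hPQ => ?_⟩
  -- Maximality among left ideals omitting `e` is full maximality: once `e ∈ Q`, every `a = (a - a
  -- e) + a e` lies in `Q`.
  by_cases heQ : e ∈ Q
  · refine Or.inr (eq_top_iff.2 fun a _ => ?_)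
    have := add_mem (hPQ (hNP (hmod a))) (hQ a e heQ)
    rwa [sub_add_cancel] at this
  · exact Or.inl (le_antisymm (hP.le_of_ge ⟨hNP.trans hPQ, heQ, hQ⟩ hPQ) hPQ)

/-- The action of a ring on its quotient by a left ideal. -/
def quotientAction (P : AddSubgroup R) (hP : ∀ a, ∀ b ∈ P, a * b ∈ P) :
    R →ₙ+* AddMonoid.End (R ⧸ P) where
  toFun a := QuotientAddGroup.map P P (AddMonoidHom.mulLeft a) fun b hb => hP a b hb
  map_zero' := by
    refine AddMonoidHom.ext fun c => ?_
    obtain ⟨c, rfl⟩ := QuotientAddGroup.mk_surjective c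
    change ((0 * c : R) : R ⧸ P) = ((0 : R) : R ⧸ P)
    rw [zero_mul]
  map_add' a b := by
    refine AddMonoidHom.ext fun c => ?_
    obtain ⟨c, rfl⟩ := QuotientAddGroup.mk_surjective c
    change (((a + b) * c : R) : R ⧸ P) = ((a * c + b * c : R) : R ⧸ P)
    rw [add_mul]
  map_mul' a b := by
    refine AddMonoidHom.ext fun c => ?_
    obtain ⟨c, rfl⟩ := QuotientAddGroup.mk_surjective c
    change ((a * b * c : R) : R ⧸ P) = ((a * (b * c) : R) : R ⧸ P)
    rw [mul_assoc]

theorem quotientAction_apply (P : AddSubgroup R) (hP : ∀ a, ∀ b ∈ P, a * b ∈ P) (a b : R) :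
    quotientAction P hP a (b : R ⧸ P) = ((a * b : R) : R ⧸ P) :=
  rfl

theorem quotientAction_simple {P : AddSubgroup R} (hP : ∀ a, ∀ b ∈ P, a * b ∈ P)
    (hmax : ∀ Q : AddSubgroup R, (∀ a, ∀ b ∈ Q, a * b ∈ Q) → P ≤ Q → Q = P ∨ Q = ⊤)
    (N : AddSubgroup (R ⧸ P)) (hN : ∀ (a : R), ∀ m ∈ N, quotientAction P hP a m ∈ N) :
    N = ⊥ ∨ N = ⊤ := by
  have hmem : ∀ b : R, b ∈ N.comap (QuotientAddGroup.mk' P) ↔ (b : R ⧸ P) ∈ N := fun _ => Iff.rfl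
  rcases hmax (N.comap (QuotientAddGroup.mk' P)) (fun a b hb => hN a b hb) (fun b hb => by
    rw [hmem, (QuotientAddGroup.eq_zero_iff b).2 hb]
    exact zero_mem N) with h | h
  · left
    refine (AddSubgroup.eq_bot_iff_forall N).2 fun m hm => ?_
    obtain ⟨b, rfl⟩ := QuotientAddGroup.mk_surjective m
    rwa [QuotientAddGroup.eq_zero_iff, ← h]
  · right
    refine eq_top_iff.2 fun m _ => ?_
    obtain ⟨b, rfl⟩ := QuotientAddGroup.mk_surjective m
    rw [← hmem, h]
    trivial

end Modular

namespace DirGraph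

variable {E : DirGraph.{u, w}}

/-- Under Condition (MT3) and the Countable Separation Property there is an increasing sequence of
paths such that every vertex reaches the range of one of them. -/
theorem exists_path_sequence [Nonempty E.Vertex] (hM : E.ConditionMT3)
    (hC : E.HasCSP Set.univ) :
    ∃ (v : E.Vertex) (p : ℕ → List E.Edge) (x : ℕ → E.Vertex), (∀ n, E.IsPath v (p n) (x n)) ∧
      (∀ n, p n <+: p (n + 1)) ∧ p 0 = [] ∧ ∀ w, ∃ n, E.Reaches w (x n) := by
  obtain ⟨C, hCc, hC⟩ := hC
  obtain ⟨v⟩ := ‹Nonempty E.Vertex›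
  obtain ⟨y, hy, -⟩ := hC v trivial
  obtain ⟨c, rfl⟩ := hCc.exists_eq_range ⟨y, hy⟩
  have step : ∀ (n : ℕ) (a : {a : List E.Edge × E.Vertex // E.IsPath v a.1 a.2}),
      ∃ b : {a : List E.Edge × E.Vertex // E.IsPath v a.1 a.2},
        a.1.1 <+: b.1.1 ∧ E.Reaches (c n) b.1.2 := by
    rintro n ⟨⟨p, x⟩, hp⟩
    -- (MT3) extends the current path to a descendant of the next vertex in the enumeration of `C`.
    obtain ⟨y, ⟨q, hq⟩, hy⟩ := hM x (c n)
    exact ⟨⟨⟨p ++ q, y⟩, hp.append hq⟩, List.prefix_append p q, hy⟩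
  choose next hnext hnext' using step
  let a : ℕ → {a : List E.Edge × E.Vertex // E.IsPath v a.1 a.2} :=
    fun n => Nat.rec ⟨⟨[], v⟩, rfl⟩ next n
  refine ⟨v, fun n => (a n).1.1, fun n => (a n).1.2, fun n => (a n).2, fun n => hnext n (a n),
    rfl, fun w => ?_⟩
  obtain ⟨_, ⟨n, rfl⟩, hw⟩ := hC w trivial
  exact ⟨n + 1, hw.trans (hnext' n (a n))⟩

end DirGraph

namespace LeavittPathAlgebra

open DirGraph

variable {K : Type k} [Field K] {E : DirGraph.{u, w}}

theorem pth_ne_zero {u v : E.Vertex} {p : List E.Edge} (hp : E.IsPath u p v) : pth K u p ≠ 0 := by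
  intro h
  apply vtx_ne_zero K v
  rw [← gpth_mul_pth_self hp, h, mul_zero]

theorem isLeftPrimitive_of_conditions [Nonempty E.Vertex] (hM : E.ConditionMT3)
    (hL : E.ConditionL) (hC : E.HasCSP Set.univ) : IsLeftPrimitive (LeavittPathAlgebra K E) := by
  obtain ⟨v, p, x, hp, hpre, hp0, hx⟩ := exists_path_sequence hM hC
  have hmono : ∀ {m n}, m ≤ n → p m <+: p n := fun {m n} h =>
    Nat.le_induction List.prefix_rfl (fun n _ ih => ih.trans (hpre n)) n h
  have hkill : ∀ {m n} (a : LeavittPathAlgebra K E), m ≤ n → a * pth K v (p m) = 0 →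
      a * pth K v (p n) = 0 := by
    intro m n a h ha
    obtain ⟨t, ht⟩ := hmono h
    have hn := hp n
    rw [← ht] at hn ⊢
    rw [pth_append (hp m) ((hp m).of_append hn), ← mul_assoc, ha, zero_mul]
  let N : AddSubgroup (LeavittPathAlgebra K E) :=
    { carrier := {a | ∃ n, a * pth K v (p n) = 0}
      zero_mem' := ⟨0, zero_mul _⟩
      add_mem' := by
        rintro a b ⟨m, ha⟩ ⟨n, hb⟩
        refine ⟨max m n, ?_⟩
        rw [add_mul, hkill a (le_max_left m n) ha, hkill b (le_max_right m n) hb, add_zero]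
      neg_mem' := by
        rintro a ⟨n, ha⟩
        exact ⟨n, by rw [neg_mul, ha, neg_zero]⟩ }
  have hmemN : ∀ a, a ∈ N ↔ ∃ n, a * pth K v (p n) = 0 := fun _ => Iff.rfl
  obtain ⟨P, hNP, hvP, hP, hmax⟩ := exists_simple_quotient N (e := vtx K v)
    (by
      rintro a b ⟨n, hb⟩
      exact ⟨n, by rw [mul_assoc, hb, mul_zero]⟩)
    (by
      rintro ⟨n, hn⟩
      rw [vtx_mul_pth (hp n)] at hn
      exact pth_ne_zero (hp n) hn)
    (fun a => ⟨0, by rw [hp0, pth, sub_mul, mul_assoc, vtx_mul_self, sub_self]⟩)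
  refine ⟨LeavittPathAlgebra K E ⧸ P, inferInstance, quotientAction P hP,
    ⟨vtx K v, (vtx K v : LeavittPathAlgebra K E), ?_⟩, quotientAction_simple hP hmax, ?_⟩
  · rw [quotientAction_apply, vtx_mul_self]
    exact fun h => hvP ((QuotientAddGroup.eq_zero_iff _).1 h)
  · intro a ha
    refine injective_of_conditionL hL (ρ := quotientAction P hP) (fun w hw => hvP ?_)
      (AddMonoidHom.ext ha)
    obtain ⟨n, q, hq⟩ := hx w
    -- If `w` annihilated the quotient, `w (q pₙ*) = q pₙ*` would lie in `P`; multiplying by `pₙ q*`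
    -- gives `pₙ pₙ* ∈ P`. As `(v - pₙ pₙ*) pₙ = 0`, it would follow that `v ∈ P`.
    have h1 : pth K w q * gpth K v (p n) ∈ P := by
      have := quotientAction_apply P hP (vtx K w) (pth K w q * gpth K v (p n))
      rw [hw, ← mul_assoc, vtx_mul_pth hq] at this
      exact (QuotientAddGroup.eq_zero_iff _).1 this.symm
    have h2 := hP (pth K v (p n) * gpth K w q) _ h1
    rw [mul_assoc, ← mul_assoc (gpth K w q), gpth_mul_pth_self hq, vtx_mul_gpth (hp n)] at h2
    have h3 : vtx K v - pth K v (p n) * gpth K v (p n) ∈ N := by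
      refine ⟨n, ?_⟩
      rw [sub_mul, mul_assoc, gpth_mul_pth_self (hp n), vtx_mul_pth (hp n), pth_mul_vtx (hp n),
        sub_self]
    have := add_mem (hNP h3) h2
    rwa [sub_add_cancel] at this

theorem isLeftPrimitive_iff [Nonempty E.Vertex] : IsLeftPrimitive (LeavittPathAlgebra K E) ↔
    E.ConditionMT3 ∧ E.ConditionL ∧ E.HasCSP Set.univ :=
  ⟨fun h => ⟨conditionMT3_of_isLeftPrimitive h, conditionL_of_isLeftPrimitive h,
    hasCSP_of_isLeftPrimitive h⟩, fun h => isLeftPrimitive_of_conditions h.1 h.2.1 h.2.2⟩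

end LeavittPathAlgebra

theorem theorem4 (K : Type k) [Field K] (E : DirGraph.{u, w}) [Nonempty E.Vertex] :
    (IsLeftPrimitive (LeavittPathAlgebra K E) ↔
      E.ConditionMT3 ∧ E.ConditionL ∧ E.HasCSP Set.univ) ∧
    (IsRightPrimitive (LeavittPathAlgebra K E) ↔
      E.ConditionMT3 ∧ E.ConditionL ∧ E.HasCSP Set.univ) := by
  rw [isRightPrimitive_leavittPathAlgebra_iff]
  exact ⟨LeavittPathAlgebra.isLeftPrimitive_iff, LeavittPathAlgebra.isLeftPrimitive_iff⟩
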